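/- Let $\iota:\mathfrak{so}(3)\hookrightarrow\mathfrak{so}(5)$ be an embedding of real Lie algebras for which the vector representation $\mathbb{R}^5$ of $\mathfrak{so}(5)$ stays irreducible under $\mathfrak{so}(3)$; it defines the Berger space $M=SO(5)/SO(3)$. Let $b$ be the Killing form of $\mathfrak{so}(5)$, let $\mathfrak{p}=\iota(\mathfrak{so}(3))^{\perp_b}\subset\mathfrak{so}(5)$, equipped with the inner product $-b$, and let $\zeta_*:\mathfrak{so}(3)\to\mathfrak{so}(\mathfrak{p})$, $\zeta_*(h)v=[\iota(h),v]$, be the isotropy representation. Let $C\ell(\mathfrak{p})$ be the Clifford algebra of $\mathfrak{p}$ with the relation $v\cdot v=b(v,v)=-|v|^2$, let $\{e_i\}$ be an orthonormal basis of $\mathfrak{p}$, and let $$\tilde\zeta_*:\mathfrak{so}(3)\to C\ell(\mathfrak{p}),\qquad \tilde\zeta_*(h)=\tfrac14\sum_i e_i\cdot\zeta_*(h)(e_i),$$ be the lift of $\zeta_*$ to $\mathfrak{spin}(\mathfrak{p})\subset C\ell(\mathfrak{p})$. Let $\gamma: C\ell(\mathfrak{p})\to\mathrm{End}_{\mathbb{C}}(\Delta)$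 be an irreducible complex Clifford module and $\rho_*=\gamma\circ\tilde\zeta_*$ the spinor representation of $\mathfrak{so}(3)$ on $\Delta$. Label the irreducible complex representations of $\mathfrak{so}(3)$ by their highest weights $(k)$, $k\in\mathbb{N}_0$, normalised so that the roots of $\mathfrak{so}(3)$ are $\pm2$ (thus $(k)$ has dimension $k+1$). Then $\dim_{\mathbb{C}}\Delta=8$, and the spinor representation splits under $\mathfrak{so}(3)$ as $$\mathbf{8}=\mathbf{7}\oplus\mathbf{1},$$ that is, $\Delta=W_6\oplus W_0$ with irreducible $\mathfrak{so}(3)$-invariant subspaces $W_6$ of dimension $7$ and highest weight $(6)$, and $W_0$ of dimension $1$ and highest weight $(0)$. -/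

import Mathlib

attribute [local instance 100] LieRing.ofAssociativeRing

noncomputable section

namespace BergerSpace

/-- The real Lie algebra `so(n)` of skew-symmetric real `n × n` matrices. -/
abbrev so (n : ℕ) : LieSubalgebra ℝ (Matrix (Fin n) (Fin n) ℝ) :=
  LieAlgebra.Orthogonal.so (Fin n) ℝ

/-- `W` is an irreducible subspace for a set `S` of operators on `V`: it is non-zero, it is
invariant under `S`, and it has no `S`-invariant subspaces other than `0` and `W`. -/
def IsIrreducibleSubspace {K V : Type*} [Field K] [AddCommGroup V] [Module K V]
    (S : Set (Module.End K V)) (W : Submodule K V) : Prop :=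
  W ≠ ⊥ ∧ (∀ f ∈ S, W ∈ f.invtSubmodule) ∧
    ∀ U ≤ W, (∀ f ∈ S, U ∈ f.invtSubmodule) → U = ⊥ ∨ U = W

section Isotropy

variable {n : ℕ} {κ : Type*} [Fintype κ] [DecidableEq κ] (ι : so 3 →ₗ⁅ℝ⁆ so n)

/-- The complement `𝔭` of `𝔨 = ι(so(3))` in `𝔤 = so(n)`, orthogonal for the Killing form
of `so(n)`. -/
def complement : Submodule ℝ (so n) :=
  (killingForm ℝ (so n)).orthogonal ι.range.toSubmodule

theorem lie_mem_complement (h : so 3) {v : so n} (hv : v ∈ complement ι) :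
    ⁅ι h, v⁆ ∈ complement ι := by
  intro k hk
  obtain ⟨k, rfl⟩ := hk
  change killingForm ℝ (so n) (ι k) ⁅ι h, v⁆ = 0
  rw [← LieModule.traceForm_apply_lie_apply]
  exact hv _ ⟨⁅k, h⁆, by simp⟩

/-- The infinitesimal isotropy representation `ζ_* : so(3) → End(𝔭)`, `ζ_*(h) v = [ι h, v]`. -/
def isotropyRep : so 3 →ₗ⁅ℝ⁆ Module.End ℝ (complement ι) where
  toFun h := (LieAlgebra.ad ℝ (so n) (ι h)).restrict
    fun _ hv => lie_mem_complement ι h hv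
  map_add' x y := by
    ext v : 2
    change ⁅ι (x + y), (v : so n)⁆ = ⁅ι x, (v : so n)⁆ + ⁅ι y, (v : so n)⁆
    rw [map_add, add_lie]
  map_smul' c x := by
    ext v : 2
    change ⁅ι (c • x), (v : so n)⁆ = c • ⁅ι x, (v : so n)⁆
    rw [map_smul, smul_lie]
  map_lie' {x y} := by
    ext v : 2
    change ⁅ι ⁅x, y⁆, (v : so n)⁆ = ⁅ι x, ⁅ι y, (v : so n)⁆⁆ - ⁅ι y, ⁅ι x, (v : so n)⁆⁆
    rw [LieHom.map_lie, lie_lie]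

/-- The Killing form of `so(n)` restricted to `𝔭`, as a quadratic form. The Riemannian metric of
the homogeneous space is its negative, so that the Clifford relation reads `v * v = -‖v‖²`. -/
def killingQuadraticForm : QuadraticForm ℝ (complement ι) :=
  (killingForm ℝ (so n)).toQuadraticMap.comp (complement ι).subtype

/-- The Clifford algebra `Cℓ(𝔭)`. -/
abbrev Cl : Type := CliffordAlgebra (killingQuadraticForm ι)

/-- The basis `e` of `𝔭` is orthonormal for the metric `-(Killing form)`. -/
def IsOrthonormalBasis (e : Module.Basis κ ℝ (complement ι)) : Prop :=
  ∀ i j, -killingForm ℝ (so n) (e i) (e j) = if i = j then 1 else 0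

/-- The lift of the isotropy representation to the Clifford algebra,
`h ↦ 1/4 ∑ᵢ eᵢ · ζ_*(h) eᵢ`, as a linear map. -/
def spinLiftLinear (e : Module.Basis κ ℝ (complement ι)) : so 3 →ₗ[ℝ] Cl ι where
  toFun h := (1 / 4 : ℝ) • ∑ i, CliffordAlgebra.ι (killingQuadraticForm ι) (e i) *
    CliffordAlgebra.ι (killingQuadraticForm ι) (isotropyRep ι h (e i))
  map_add' x y := by simp [mul_add, Finset.sum_add_distrib]
  map_smul' c x := by
    simp only [map_smul, LinearMap.smul_apply, mul_smul_comm, RingHom.id_apply]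
    rw [← Finset.smul_sum, smul_comm]

theorem polar_killing (a b : complement ι) :
    QuadraticMap.polar (killingQuadraticForm ι) a b = 2 * killingForm ℝ (so n) a b := by
  have := LieModule.traceForm_comm ℝ (so n) (so n) (a : so n) b
  simp only [QuadraticMap.polar, killingQuadraticForm, QuadraticMap.comp_apply,
    Submodule.subtype_apply, LinearMap.BilinMap.toQuadraticMap_apply, map_add,
    LinearMap.add_apply]
  rw [this]; ring

variable {ι}

theorem expand {e : Module.Basis κ ℝ (complement ι)} (he : IsOrthonormalBasis ι e)
    (v : complement ι) : v = ∑ i, (-killingForm ℝ (so n) (e i) v) • e i := by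
  conv_lhs => rw [← e.sum_repr v]
  refine Finset.sum_congr rfl fun i _ => ?_
  congr 1
  have h : ∀ j, killingForm ℝ (so n) (e i) (e j) = -(if i = j then 1 else 0) := fun j => by
    rw [← he i j, neg_neg]
  have hv : (v : so n) = ∑ j, e.repr v j • (e j : so n) := by
    have h1 := congrArg (complement ι).subtype (e.sum_repr v)
    rw [map_sum] at h1
    exact h1.symm
  rw [hv, map_sum]
  simp only [map_smul, h]
  simp

theorem killing_isotropyRep (h : so 3) (v w : complement ι) :
    killingForm ℝ (so n) (isotropyRep ι h v) w = -killingForm ℝ (so n) v (isotropyRep ι h w) :=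
  LieModule.traceForm_apply_lie_apply' ℝ (so n) (so n) (ι h) v w

/-- `[ζ̃_*(h), v] = ζ_*(h) v` in the Clifford algebra. -/
theorem spinLift_commutator {e : Module.Basis κ ℝ (complement ι)} (he : IsOrthonormalBasis ι e)
    (h : so 3) (v : complement ι) :
    ⁅spinLiftLinear ι e h, CliffordAlgebra.ι (killingQuadraticForm ι) v⁆ =
      CliffordAlgebra.ι (killingQuadraticForm ι) (isotropyRep ι h v) := by
  set g := CliffordAlgebra.ι (killingQuadraticForm ι) with hg
  have key : ∀ a b : complement ι, g a * g b * g v - g v * (g a * g b) =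
      g ((2 * killingForm ℝ (so n) b v) • a - (2 * killingForm ℝ (so n) a v) • b) := by
    intro a b
    have h1 := CliffordAlgebra.ι_mul_ι_add_swap (Q := killingQuadraticForm ι) b v
    have h2 := CliffordAlgebra.ι_mul_ι_add_swap (Q := killingQuadraticForm ι) a v
    rw [polar_killing, ← hg] at h1 h2
    have : g a * g b * g v - g v * (g a * g b) =
        g a * (g b * g v + g v * g b) - (g a * g v + g v * g a) * g b := by noncomm_ring
    rw [this, h1, h2, map_sub, map_smul, map_smul, ← Algebra.commutes, ← Algebra.smul_def,
      ← Algebra.smul_def]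
  have h3 : ⁅spinLiftLinear ι e h, g v⁆ = (1 / 4 : ℝ) • ∑ i,
      (g (e i) * g (isotropyRep ι h (e i)) * g v - g v * (g (e i) * g (isotropyRep ι h (e i)))) := by
    rw [LieRing.of_associative_ring_bracket]
    simp only [spinLiftLinear, LinearMap.coe_mk, AddHom.coe_mk, smul_mul_assoc, mul_smul_comm,
      Finset.sum_mul, Finset.mul_sum, Finset.sum_sub_distrib, smul_sub, hg]
  rw [h3]
  simp only [key]
  rw [← map_sum, ← map_smul]
  congr 1
  have e1 := expand he (isotropyRep ι h v)
  have e2 := congrArg (isotropyRep ι h) (expand he v)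
  rw [map_sum] at e2
  simp only [map_smul] at e2
  have e3 : ∑ i, ((2 * killingForm ℝ (so n) (isotropyRep ι h (e i)) v) • e i -
      (2 * killingForm ℝ (so n) (e i) v) • isotropyRep ι h (e i)) =
      (2 : ℝ) • ∑ i, (-killingForm ℝ (so n) (e i) (isotropyRep ι h v)) • e i +
      (2 : ℝ) • ∑ i, (-killingForm ℝ (so n) (e i) v) • isotropyRep ι h (e i) := by
    rw [Finset.smul_sum, Finset.smul_sum, ← Finset.sum_add_distrib]
    refine Finset.sum_congr rfl fun i _ => ?_
    rw [killing_isotropyRep, smul_smul, smul_smul, mul_neg, mul_neg, sub_eq_add_neg, ← neg_smul]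
  rw [e3, ← e1, ← e2]
  module

theorem sum_isotropyRep {e : Module.Basis κ ℝ (complement ι)} (he : IsOrthonormalBasis ι e)
    (x y : so 3) :
    ∑ i, CliffordAlgebra.ι (killingQuadraticForm ι) (isotropyRep ι x (e i)) *
        CliffordAlgebra.ι (killingQuadraticForm ι) (isotropyRep ι y (e i)) =
      -∑ i, CliffordAlgebra.ι (killingQuadraticForm ι) (e i) *
        CliffordAlgebra.ι (killingQuadraticForm ι) (isotropyRep ι y (isotropyRep ι x (e i))) := by
  set g := CliffordAlgebra.ι (killingQuadraticForm ι)
  have hL : ∀ i, g (isotropyRep ι x (e i)) * g (isotropyRep ι y (e i)) =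
      ∑ j, (-killingForm ℝ (so n) (e j) (isotropyRep ι x (e i))) •
        (g (e j) * g (isotropyRep ι y (e i))) := fun i => by
    conv_lhs => rw [expand he (isotropyRep ι x (e i))]
    simp [map_sum, Finset.sum_mul]
  have hR : ∀ i, g (e i) * g (isotropyRep ι y (isotropyRep ι x (e i))) =
      ∑ j, (-killingForm ℝ (so n) (e j) (isotropyRep ι x (e i))) •
        (g (e i) * g (isotropyRep ι y (e j))) := fun i => by
    conv_lhs => rw [expand he (isotropyRep ι x (e i))]
    simp [map_sum, Finset.mul_sum]
  simp only [hL, hR]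
  rw [Finset.sum_comm, ← Finset.sum_neg_distrib]
  refine Finset.sum_congr rfl fun i _ => ?_
  rw [← Finset.sum_neg_distrib]
  refine Finset.sum_congr rfl fun j _ => ?_
  rw [← neg_smul, neg_neg, ← killing_isotropyRep]
  congr 1
  exact LieModule.traceForm_comm ..

/-- The lift `ζ̃_* : so(3) → spin(𝔭) ⊂ Cℓ(𝔭)`, `ζ̃_*(h) = 1/4 ∑ᵢ eᵢ · ζ_*(h) eᵢ`, of the isotropy
representation, a homomorphism of Lie algebras (`Cℓ(𝔭)` carries the commutator bracket). -/
def spinLift {e : Module.Basis κ ℝ (complement ι)} (he : IsOrthonormalBasis ι e) :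
    so 3 →ₗ⁅ℝ⁆ Cl ι where
  toLinearMap := spinLiftLinear ι e
  map_lie' {x y} := by
    change spinLiftLinear ι e ⁅x, y⁆ = ⁅spinLiftLinear ι e x, spinLiftLinear ι e y⁆
    set g := CliffordAlgebra.ι (killingQuadraticForm ι) with hg
    have hdef : ∀ z, spinLiftLinear ι e z =
      (1 / 4 : ℝ) • ∑ i, g (e i) * g (isotropyRep ι z (e i)) := fun z => rfl
    have leib : ∀ a b c : Cl ι, ⁅a, b * c⁆ = ⁅a, b⁆ * c + b * ⁅a, c⁆ := fun a b c => by
      simp only [LieRing.of_associative_ring_bracket]; noncomm_ring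
    rw [hdef y, lie_smul, lie_sum]
    simp only [leib, hg, spinLift_commutator he]
    rw [Finset.sum_add_distrib, sum_isotropyRep he, hdef, ← hg]
    congr 1
    rw [neg_add_eq_sub, ← Finset.sum_sub_distrib]
    refine Finset.sum_congr rfl fun i _ => ?_
    rw [← mul_sub, ← map_sub, LieHom.map_lie, LieRing.of_associative_ring_bracket]
    rfl

end Isotropy

section SpinorRep

variable {n : ℕ} {κ : Type*} [Fintype κ] [DecidableEq κ] {ι : so 3 →ₗ⁅ℝ⁆ so n}
  {Δ : Type*} [AddCommGroup Δ] [Module ℂ Δ]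

/-- `Δ`, with Clifford multiplication `γ`, is a complex spinor module: an irreducible complex
module over the Clifford algebra `Cℓ(𝔭)`. -/
def IsSpinorModule (γ : Cl ι →ₐ[ℝ] Module.End ℂ Δ) : Prop :=
  IsIrreducibleSubspace (Set.range γ) ⊤

/-- The spinor representation `ρ_* = γ ∘ ζ̃_*` of `so(3)` on `Δ`. -/
def spinorRep {e : Module.Basis κ ℝ (complement ι)} (he : IsOrthonormalBasis ι e)
    (γ : Cl ι →ₐ[ℝ] Module.End ℂ Δ) : so 3 →ₗ⁅ℝ⁆ Module.End ℂ Δ :=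
  (γ : Cl ι →ₗ⁅ℝ⁆ Module.End ℂ Δ).comp (spinLift he)

end SpinorRep

section Weights

/-- The infinitesimal rotation about the first coordinate axis of `ℝ³`. Together with `L₂`, `L₃`
below it satisfies `[L₁, L₂] = L₃`, `[L₂, L₃] = L₁`, `[L₃, L₁] = L₂`. -/
def L₁ : so 3 := ⟨!![0, 0, 0; 0, 0, -1; 0, 1, 0], by
  rw [LieAlgebra.Orthogonal.mem_so]; ext i j; fin_cases i <;> fin_cases j <;> simp⟩

/-- The infinitesimal rotation about the second coordinate axis. -/
def L₂ : so 3 := ⟨!![0, 0, 1; 0, 0, 0; -1, 0, 0], by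
  rw [LieAlgebra.Orthogonal.mem_so]; ext i j; fin_cases i <;> fin_cases j <;> simp⟩

/-- The infinitesimal rotation about the third coordinate axis. -/
def L₃ : so 3 := ⟨!![0, -1, 0; 1, 0, 0; 0, 0, 0], by
  rw [LieAlgebra.Orthogonal.mem_so]; ext i j; fin_cases i <;> fin_cases j <;> simp⟩

variable {V : Type*} [AddCommGroup V] [Module ℂ V]

/-- The action of the element `H = 2i L₃` of `so(3) ⊗ ℂ`, which spans a Cartan subalgebra. -/
def weightOp (ρ : so 3 →ₗ⁅ℝ⁆ Module.End ℂ V) : Module.End ℂ V :=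
  (2 * Complex.I) • ρ L₃

/-- The action of the positive root vector `E = i L₁ - L₂` of `so(3) ⊗ ℂ`, for which
`[H, E] = 2 E`. -/
def raisingOp (ρ : so 3 →ₗ⁅ℝ⁆ Module.End ℂ V) : Module.End ℂ V :=
  Complex.I • ρ L₁ - ρ L₂

/-- The subspace `W` of the complex representation `ρ` of `so(3)` is an irreducible
subrepresentation of highest weight `(k)`: it is irreducible and contains a non-zero vector of
weight `k` (normalised so that the roots are `±2`) that is annihilated by the positive root
vector. -/
def IsIrrepOfHighestWeight (ρ : so 3 →ₗ⁅ℝ⁆ Module.End ℂ V) (W : Submodule ℂ V) (k : ℕ) : Prop :=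
  IsIrreducibleSubspace (Set.range ρ) W ∧
    ∃ v ∈ W, v ≠ 0 ∧ weightOp ρ v = (k : ℂ) • v ∧ raisingOp ρ v = 0

end Weights

end BergerSpace

end

/-!
The spinor representation is determined by weights alone; no explicit matrices for the embedding,
for the isotropy representation or for the Clifford algebra are needed.

*The isotropy representation has highest weight `(6)`.* As `5` is odd, the complexification `ℂ⁵` of
the irreducible `ℝ⁵` is irreducible (`eq_top_of_invariant`), hence of highest weight `(4)`. If `v`
is a highest weight vector, then `v ∧ F v` in `Λ²ℂ⁵ = so(5) ⊗ ℂ` is annihilated by `E` and has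
weight `6` (`exists_weight_six`). The weights of `so(3) ⊗ ℂ` itself being `0` and `±2`, this vector
lies in `𝔭 ⊗ ℂ` by invariance of the Killing form (`mem_complement_of_lie_lie`). Since
`dim 𝔭 ≤ 10 - 3`, the seven vectors of weights `6, 4, …, -6` that it generates under `F` are a
basis of `𝔭 ⊗ ℂ`.

*Clifford multiplication.* All of this is carried out inside `End(Δ)`, where the commutator with
`ρ_*(h)` acts on Clifford multiplications through the isotropy representation. The anticommutator
of two vectors is a scalar, hence commutes with `H`, so it vanishes unless the weights are opposite;
that it does not vanish for opposite weights follows from the definiteness of the Killing form on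
`𝔭` (`exists_primitive_vectorSpan`, `string_anticomm`). So the vectors of weights `6, 4, 2` act as
annihilation operators, those of opposite weights as creation operators, and the vector of weight
`0` as a further Clifford generator.

*Weights of spinors.* An irreducible module over these operators is a Fock space of dimension
`2³ = 8` (`IsFermionic.exists_basis`). If the vacuum has weight `c`, then the weights are `c` minus
the sums over the subsets of `{6, 4, 2}`; as `H = [E, F]` has trace zero, `c = 6`, and the weights
are `6, 4, 2, 0, 0, -2, -4, -6` (`IsFermionic.exists_weight_basis`). The vacuum generates the
summand `(6)`. A suitable vector of the two-dimensional weight space for `0` is annihilated by `E`,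
whose values there lie in the line of weight `2`, and spans the summand `(0)`
(`exists_decomposition`).
-/

namespace BergerSpace

open Module LieModule

/-! ### Representations of `sl₂` and of `so(3)` -/

theorem lie_L₁_L₂ : ⁅L₁, L₂⁆ = L₃ := by
  apply Subtype.ext
  rw [LieSubalgebra.coe_bracket, LieRing.of_associative_ring_bracket]
  ext i j; fin_cases i <;> fin_cases j <;> simp [L₁, L₂, L₃]

theorem lie_L₂_L₃ : ⁅L₂, L₃⁆ = L₁ := by
  apply Subtype.ext
  rw [LieSubalgebra.coe_bracket, LieRing.of_associative_ring_bracket]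
  ext i j; fin_cases i <;> fin_cases j <;> simp [L₁, L₂, L₃]

theorem lie_L₃_L₁ : ⁅L₃, L₁⁆ = L₂ := by
  apply Subtype.ext
  rw [LieSubalgebra.coe_bracket, LieRing.of_associative_ring_bracket]
  ext i j; fin_cases i <;> fin_cases j <;> simp [L₁, L₂, L₃]

theorem so_apply_swap {n : ℕ} (x : so n) (i j : Fin n) :
    (x : Matrix (Fin n) (Fin n) ℝ) j i = -(x : Matrix (Fin n) (Fin n) ℝ) i j := by
  have h := (LieAlgebra.Orthogonal.mem_so (Fin n) ℝ x).1 x.2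
  simpa using congrFun (congrFun h i) j

theorem so_three_eq (x : so 3) : ∃ a b c : ℝ, x = a • L₁ + b • L₂ + c • L₃ := by
  refine ⟨x.1 2 1, x.1 0 2, x.1 1 0, Subtype.ext ?_⟩
  have h := so_apply_swap x
  have hd : ∀ i, x.1 i i = 0 := fun i => by linarith [h i i]
  ext i j; fin_cases i <;> fin_cases j <;>
    simp [L₁, L₂, L₃, hd, h 0 1, h 1 2, h 2 0]

section String

open IsSl2Triple

variable {L M : Type*} [LieRing L] [LieAlgebra ℂ L] [AddCommGroup M] [Module ℂ M]
  [LieRingModule L M] [LieModule ℂ L M] {h e f : L} {t : IsSl2Triple h e f} {m : M} {k : ℕ}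

/-- The vectors `m, f m, …, fᵏ m` obtained from a primitive vector of weight `k` are linearly
independent, having different weights. -/
theorem linearIndependent_string (P : HasPrimitiveVectorWith t m (k : ℂ)) :
    LinearIndependent ℂ fun j : Fin (k + 1) => (toEnd ℂ L M f ^ (j : ℕ)) m := by
  refine Module.End.eigenvectors_linearIndependent' (toEnd ℂ L M h)
    (fun j : Fin (k + 1) => (k - 2 * (j : ℕ) : ℂ)) (fun i j hij => ?_) _ fun j => ⟨?_, ?_⟩
  · have : ((i : ℕ) : ℂ) = (j : ℕ) := by linear_combination (-1 / 2 : ℂ) * hij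
    exact Fin.ext (by exact_mod_cast this)
  · rw [Module.End.mem_eigenspace_iff]
    exact P.lie_h_pow_toEnd_f j
  · exact P.pow_toEnd_f_ne_zero_of_eq_nat rfl (by omega)

variable (L f m k) in
/-- The span of the `f`-string `m, f m, …, fᵏ m`. -/
def stringSpan : Submodule ℂ M :=
  Submodule.span ℂ (Set.range fun j : Fin (k + 1) => (toEnd ℂ L M f ^ (j : ℕ)) m)

theorem finrank_stringSpan (P : HasPrimitiveVectorWith t m (k : ℂ)) :
    finrank ℂ (stringSpan L f m k) = k + 1 := by
  rw [stringSpan, finrank_span_eq_card (linearIndependent_string P), Fintype.card_fin]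

theorem pow_mem_stringSpan {j : ℕ} (hj : j ≤ k) :
    (toEnd ℂ L M f ^ j) m ∈ stringSpan L f m k :=
  Submodule.subset_span ⟨⟨j, by omega⟩, rfl⟩

theorem f_mem_stringSpan [FiniteDimensional ℂ M] (P : HasPrimitiveVectorWith t m (k : ℂ)) {x : M}
    (hx : x ∈ stringSpan L f m k) : ⁅f, x⁆ ∈ stringSpan L f m k := by
  induction hx using Submodule.span_induction with
  | mem x hx =>
    obtain ⟨j, rfl⟩ := hx
    dsimp only
    rw [P.lie_f_pow_toEnd_f]
    by_cases hj : (j : ℕ) = k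
    · rw [hj, P.pow_toEnd_f_eq_zero_of_eq_nat rfl]
      exact zero_mem _
    · exact pow_mem_stringSpan (by omega)
  | zero => simp
  | add x y _ _ hx hy => rw [lie_add]; exact add_mem hx hy
  | smul c x _ hx => rw [lie_smul]; exact Submodule.smul_mem _ _ hx

theorem e_mem_stringSpan (P : HasPrimitiveVectorWith t m (k : ℂ)) {x : M}
    (hx : x ∈ stringSpan L f m k) : ⁅e, x⁆ ∈ stringSpan L f m k := by
  induction hx using Submodule.span_induction with
  | mem x hx =>
    obtain ⟨⟨j, hj⟩, rfl⟩ := hx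
    dsimp only
    cases j with
    | zero => simp [P.lie_e]
    | succ j =>
      rw [P.lie_e_pow_succ_toEnd_f]
      exact Submodule.smul_mem _ _ (pow_mem_stringSpan (by omega))
  | zero => simp
  | add x y _ _ hx hy => rw [lie_add]; exact add_mem hx hy
  | smul c x _ hx => rw [lie_smul]; exact Submodule.smul_mem _ _ hx

/-- Up to scalars, `m` is the only vector of its string that is annihilated by `e`. -/
theorem eq_smul_of_lie_e_eq_zero (P : HasPrimitiveVectorWith t m (k : ℂ)) {x : M}
    (hx : x ∈ stringSpan L f m k) (hex : ⁅e, x⁆ = 0) : ∃ c : ℂ, x = c • m := by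
  obtain ⟨c, rfl⟩ := (Submodule.mem_span_range_iff_exists_fun ℂ).1 hx
  rw [Fin.sum_univ_succ] at hex ⊢
  have hli := (linearIndependent_string P).comp _ (Fin.castSucc_injective k)
  have h0 : ∑ i : Fin k, (c i.succ * (((i : ℕ) + 1) * (k - (i : ℕ)))) •
      (toEnd ℂ L M f ^ (i : ℕ)) m = 0 := by
    rw [← hex, lie_add, lie_sum]
    simp [P.lie_e, P.lie_e_pow_succ_toEnd_f, smul_smul]
  have hc : ∀ i : Fin k, c i.succ = 0 := fun i => by
    have h1 := Fintype.linearIndependent_iff.1 hli _ h0 i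
    have h2 : ((i : ℕ) + 1 : ℂ) ≠ 0 := Nat.cast_add_one_ne_zero _
    have h3 : (k - (i : ℕ) : ℂ) ≠ 0 := sub_ne_zero.2 (by exact_mod_cast i.2.ne')
    simpa [h2, h3] using h1
  exact ⟨c 0, by simp [hc]⟩

/-- The string through a primitive vector spans an irreducible module: a non-zero invariant
subspace contains a vector annihilated by `e`, hence `m`, hence everything. -/
theorem stringSpan_le_of_invariant [FiniteDimensional ℂ M]
    (P : HasPrimitiveVectorWith t m (k : ℂ)) {U : Submodule ℂ M} (hU : U ≤ stringSpan L f m k)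
    (hne : U ≠ ⊥) (he : ∀ x ∈ U, ⁅e, x⁆ ∈ U) (hf : ∀ x ∈ U, ⁅f, x⁆ ∈ U) :
    stringSpan L f m k ≤ U := by
  obtain ⟨x, hxU, hx0⟩ := U.ne_bot_iff.1 hne
  have hpow : ∀ i, (toEnd ℂ L M e ^ i) x ∈ U := fun i => by
    induction i with
    | zero => simpa
    | succ i ih => rw [pow_succ']; exact he _ ih
  have hnil : ∀ j : ℕ, ∀ i < j, (toEnd ℂ L M e ^ j) ((toEnd ℂ L M f ^ i) m) = 0 := by
    intro j
    induction j with
    | zero => simp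
    | succ j ih =>
      intro i hi
      rw [pow_succ, Module.End.mul_apply, toEnd_apply_apply]
      cases i with
      | zero => simp [P.lie_e]
      | succ i => rw [P.lie_e_pow_succ_toEnd_f, map_smul, ih i (by omega), smul_zero]
  have hlast : (toEnd ℂ L M e ^ (k + 1)) x = 0 := by
    have hle : stringSpan L f m k ≤ LinearMap.ker (toEnd ℂ L M e ^ (k + 1)) := by
      rw [stringSpan, Submodule.span_le]
      rintro _ ⟨j, rfl⟩
      exact hnil _ _ j.2
    exact hle (hU hxU)
  obtain ⟨i, hi0, hi1⟩ := Nat.exists_not_and_succ_of_not_zero_of_exists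
    (p := fun i => (toEnd ℂ L M e ^ i) x = 0) (by simpa using hx0) ⟨_, hlast⟩
  obtain ⟨c, hc⟩ := eq_smul_of_lie_e_eq_zero P (hU (hpow i))
    (by rw [lie_e_pow_toEnd_e]; exact hi1)
  have hm : m ∈ U := by
    have hc0 : c ≠ 0 := by rintro rfl; exact hi0 (by simp [hc])
    have := U.smul_mem c⁻¹ (hpow i)
    rwa [hc, smul_smul, inv_mul_cancel₀ hc0, one_smul] at this
  rw [stringSpan, Submodule.span_le]
  rintro _ ⟨j, rfl⟩
  change (toEnd ℂ L M f ^ (j : ℕ)) m ∈ U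
  generalize (j : ℕ) = j
  induction j with
  | zero => simpa
  | succ j ih => rw [pow_succ']; exact hf _ ih

end String

section Sl2

variable {V : Type*} [AddCommGroup V] [Module ℂ V] (ρ : so 3 →ₗ⁅ℝ⁆ Module.End ℂ V)

/-- The action of the negative root vector `F = i L₁ + L₂` of `so(3) ⊗ ℂ`. -/
noncomputable def loweringOp : Module.End ℂ V :=
  Complex.I • ρ L₁ + ρ L₂

/-- The relations of `L₁`, `L₂`, `L₃` in the representation `ρ`. -/
theorem lie_rep :
    ρ L₁ * ρ L₂ - ρ L₂ * ρ L₁ = ρ L₃ ∧ ρ L₂ * ρ L₃ - ρ L₃ * ρ L₂ = ρ L₁ ∧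
      ρ L₃ * ρ L₁ - ρ L₁ * ρ L₃ = ρ L₂ := by
  refine ⟨?_, ?_, ?_⟩ <;> rw [← LieRing.of_associative_ring_bracket, ← LieHom.map_lie]
  · rw [lie_L₁_L₂]
  · rw [lie_L₂_L₃]
  · rw [lie_L₃_L₁]

theorem isSl2Triple (h : weightOp ρ ≠ 0) :
    IsSl2Triple (weightOp ρ) (raisingOp ρ) (loweringOp ρ) := by
  obtain ⟨h1, h2, h3⟩ := lie_rep ρ
  refine ⟨h, ?_, ?_, ?_⟩ <;>
    simp only [weightOp, raisingOp, loweringOp, LieRing.of_associative_ring_bracket, mul_add,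
      add_mul, mul_sub, sub_mul, smul_mul_assoc, mul_smul_comm, smul_smul]
  · linear_combination (norm := module) (2 * Complex.I) • h1
  · linear_combination (norm := skip)
      (2 * Complex.I * Complex.I) • h3 + (2 * Complex.I) • h2
    match_scalars <;> ring_nf <;> simp
  · linear_combination (norm := skip)
      (2 * Complex.I * Complex.I) • h3 - (2 * Complex.I) • h2
    match_scalars <;> ring_nf <;> simp

theorem rep_eq (x : so 3) :
    ∃ a b c : ℂ, ρ x = a • weightOp ρ + b • raisingOp ρ + c • loweringOp ρ := by
  obtain ⟨a, b, c, rfl⟩ := so_three_eq x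
  refine ⟨-c * Complex.I / 2, -a * Complex.I / 2 - b / 2, -a * Complex.I / 2 + b / 2, ?_⟩
  simp only [map_add, map_smul, weightOp, raisingOp, loweringOp, ← Complex.coe_smul]
  match_scalars <;> ring_nf <;> simp

/-- A subspace is invariant under `so(3)` as soon as it is invariant under the raising and the
lowering operator, whose commutator is the weight operator. -/
theorem invariant_iff (h : weightOp ρ ≠ 0) (W : Submodule ℂ V) :
    (∀ f ∈ Set.range ρ, W ∈ f.invtSubmodule) ↔
      (∀ x ∈ W, raisingOp ρ x ∈ W) ∧ ∀ x ∈ W, loweringOp ρ x ∈ W := by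
  constructor
  · intro hW
    have hW' : ∀ y, ∀ x ∈ W, ρ y x ∈ W := fun y x hx => hW _ ⟨y, rfl⟩ hx
    refine ⟨fun x hx => ?_, fun x hx => ?_⟩
    · exact W.sub_mem (W.smul_mem _ (hW' _ x hx)) (hW' _ x hx)
    · exact W.add_mem (W.smul_mem _ (hW' _ x hx)) (hW' _ x hx)
  · rintro ⟨hE, hF⟩ _ ⟨y, rfl⟩ x hx
    have hH : weightOp ρ x ∈ W := by
      rw [← (isSl2Triple ρ h).lie_e_f]
      exact W.sub_mem (hE _ (hF _ hx)) (hF _ (hE _ hx))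
    obtain ⟨a, b, c, e⟩ := rep_eq ρ y
    change ρ y x ∈ W
    rw [e]
    exact W.add_mem (W.add_mem (W.smul_mem _ hH) (W.smul_mem _ (hE _ hx))) (W.smul_mem _ (hF _ hx))

/-- The string through a primitive vector of weight `k` spans an irreducible representation of
highest weight `(k)`. -/
theorem isIrrepOfHighestWeight_stringSpan [FiniteDimensional ℂ V] (h : weightOp ρ ≠ 0) {v : V}
    {k : ℕ} (P : (isSl2Triple ρ h).HasPrimitiveVectorWith v (k : ℂ)) :
    IsIrrepOfHighestWeight ρ (stringSpan (Module.End ℂ V) (loweringOp ρ) v k) k := by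
  have hv : v ∈ stringSpan (Module.End ℂ V) (loweringOp ρ) v k :=
    pow_mem_stringSpan (j := 0) (Nat.zero_le k)
  refine ⟨⟨?_, ?_, ?_⟩, v, hv, P.ne_zero, P.lie_h, P.lie_e⟩
  · exact (Submodule.ne_bot_iff _).2 ⟨v, hv, P.ne_zero⟩
  · exact (invariant_iff ρ h _).2 ⟨fun x => e_mem_stringSpan P, fun x => f_mem_stringSpan P⟩
  · intro U hU hinv
    obtain ⟨hE, hF⟩ := (invariant_iff ρ h _).1 hinv
    by_cases hb : U = ⊥
    · exact .inl hb
    · exact .inr (le_antisymm hU (stringSpan_le_of_invariant P hU hb hE hF))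

end Sl2

/-! ### The vector of weight `6` in `so(5) ⊗ ℂ` -/

section ComplexRep

variable {n : ℕ} (ι : so 3 →ₗ⁅ℝ⁆ so n)

/-- The representation of `so(3)` on `ℂⁿ`, the complexification of its representation on `ℝⁿ`
by means of `ι`. -/
noncomputable def complexRep : so 3 →ₗ⁅ℝ⁆ Module.End ℂ (Fin n → ℂ) where
  toFun h := Matrix.toLin' ((ι h).1.map Complex.ofRealHom)
  map_add' x y := by
    refine Eq.trans (congrArg Matrix.toLin' ?_) (map_add Matrix.toLin' _ _)
    ext i j
    simp
  map_smul' c x := by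
    refine Eq.trans (congrArg Matrix.toLin' ?_) (map_smul Matrix.toLin' (c : ℂ) _)
    ext i j
    simp
  map_lie' {x y} := by
    rw [LieHom.map_lie, LieSubalgebra.coe_bracket, LieRing.of_associative_ring_bracket,
      LieRing.of_associative_ring_bracket, Module.End.mul_eq_comp, Module.End.mul_eq_comp,
      ← Matrix.toLin'_mul, ← Matrix.toLin'_mul, ← map_sub]
    refine congrArg Matrix.toLin' ?_
    ext i j
    simp [Matrix.mul_apply]

theorem complexRep_apply (h : so 3) (x : Fin n → ℂ) :
    complexRep ι h x = ((ι h).1.map Complex.ofRealHom).mulVec x := rfl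

theorem star_complexRep (h : so 3) (x : Fin n → ℂ) :
    star (complexRep ι h x) = complexRep ι h (star x) := by
  ext i
  simp [complexRep_apply, Matrix.mulVec, dotProduct]

variable {ι}

/-- If `ℝⁿ` is irreducible, then a complex invariant subspace of `ℂⁿ` that is stable under
conjugation, being the complexification of its real points, is trivial. -/
theorem eq_bot_or_eq_top_of_star_mem
    (hirr : IsIrreducibleSubspace (Set.range fun h : so 3 => Matrix.toLin' (ι h).1) ⊤)
    {S : Submodule ℂ (Fin n → ℂ)} (hS : ∀ f ∈ Set.range (complexRep ι), S ∈ f.invtSubmodule)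
    (hstar : ∀ x ∈ S, star x ∈ S) : S = ⊥ ∨ S = ⊤ := by
  let c : (Fin n → ℝ) →ₗ[ℝ] (Fin n → ℂ) := LinearMap.compLeft Complex.ofRealCLM.toLinearMap _
  have hc : ∀ x i, c x i = (x i : ℂ) := fun _ _ => rfl
  have hinv : ∀ f ∈ (Set.range fun h : so 3 => Matrix.toLin' (ι h).1 : Set (Module.End ℝ _)),
      (S.restrictScalars ℝ).comap c ∈ f.invtSubmodule := by
    rintro _ ⟨y, rfl⟩ x hx
    change c _ ∈ S
    have : c ((ι y).1.mulVec x) = complexRep ι y (c x) := by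
      ext i
      simp [complexRep_apply, Matrix.mulVec, dotProduct, hc]
    rw [Matrix.toLin'_apply, this]
    exact hS _ ⟨y, rfl⟩ hx
  rcases hirr.2.2 _ le_top hinv with h | h
  · left
    rw [Submodule.eq_bot_iff] at h ⊢
    intro x hx
    have h1 : (fun i => (x i).re) = 0 := by
      refine h _ ?_
      change c _ ∈ S
      have : c (fun i => (x i).re) = (1 / 2 : ℂ) • (x + star x) := by
        ext i
        simp [hc, Complex.add_conj]
      rw [this]
      exact S.smul_mem _ (S.add_mem hx (hstar x hx))
    have h2 : (fun i => (x i).im) = 0 := by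
      refine h _ ?_
      change c _ ∈ S
      have : c (fun i => (x i).im) = (-Complex.I / 2 : ℂ) • (x - star x) := by
        ext i
        simp only [hc, Pi.smul_apply, Pi.sub_apply, Pi.star_apply, smul_eq_mul]
        rw [RCLike.star_def, Complex.sub_conj]
        push_cast
        linear_combination ((x i).im : ℂ) * Complex.I_mul_I
      rw [this]
      exact S.smul_mem _ (S.sub_mem hx (hstar x hx))
    ext i
    exact Complex.ext (congrFun h1 i) (congrFun h2 i)
  · right
    rw [Submodule.eq_top_iff'] at h ⊢
    intro x
    have : x = c (fun i => (x i).re) + Complex.I • c (fun i => (x i).im) := by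
      ext i
      simp [hc, mul_comm Complex.I, Complex.re_add_im]
    rw [this]
    exact S.add_mem (h _) (S.smul_mem _ (h _))

/-- If `ℝⁿ` is irreducible and `n` is odd, then `ℂⁿ` is irreducible: if an invariant subspace
`W ≠ 0` meets its conjugate trivially, then `ℂⁿ` is their direct sum, of even dimension; otherwise
the intersection, being stable under conjugation, is everything. -/
theorem eq_top_of_invariant (hn : Odd n)
    (hirr : IsIrreducibleSubspace (Set.range fun h : so 3 => Matrix.toLin' (ι h).1) ⊤)
    {W : Submodule ℂ (Fin n → ℂ)} (hW : ∀ f ∈ Set.range (complexRep ι), W ∈ f.invtSubmodule)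
    (hne : W ≠ ⊥) : W = ⊤ := by
  let W' : Submodule ℂ (Fin n → ℂ) :=
    { carrier := {x | star x ∈ W}
      add_mem' := fun {x y} hx hy => by
        simp only [Set.mem_ofPred_eq, star_add] at *; exact W.add_mem hx hy
      zero_mem' := by simp
      smul_mem' := fun c x hx => by
        simp only [Set.mem_ofPred_eq, star_smul] at *; exact W.smul_mem _ hx }
  have hmem : ∀ x, x ∈ W' ↔ star x ∈ W := fun x => Iff.rfl
  have hW' : ∀ f ∈ Set.range (complexRep ι), W' ∈ f.invtSubmodule := by
    rintro _ ⟨y, rfl⟩ x hx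
    change star (complexRep ι y x) ∈ W
    rw [star_complexRep]
    exact hW _ ⟨y, rfl⟩ hx
  have hrank : finrank ℂ W' = finrank ℂ W := by
    let j : W' ≃+ W :=
      { toFun := fun x => ⟨star x.1, x.2⟩
        invFun := fun x => ⟨star x.1, by rw [hmem, star_star]; exact x.2⟩
        left_inv := fun x => Subtype.ext (star_star _)
        right_inv := fun x => Subtype.ext (star_star _)
        map_add' := fun x y => Subtype.ext (star_add _ _) }
    refine congrArg Cardinal.toNat (rank_eq_of_equiv_equiv (star : ℂ → ℂ) j
      star_involutive.bijective fun r m => Subtype.ext ?_)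
    exact star_smul r m.1
  have hinf : W ⊓ W' = ⊥ ∨ W ⊓ W' = ⊤ := by
    refine eq_bot_or_eq_top_of_star_mem hirr ?_ ?_
    · exact fun f hf x hx => ⟨hW f hf hx.1, hW' f hf hx.2⟩
    · rintro x ⟨h1, h2⟩
      exact ⟨h2, by change star (star x) ∈ W; rwa [star_star]⟩
  have hsup : W ⊔ W' = ⊥ ∨ W ⊔ W' = ⊤ := by
    refine eq_bot_or_eq_top_of_star_mem hirr (fun f hf x hx => ?_) fun x hx => ?_
    · obtain ⟨a, ha, b, hb, rfl⟩ := Submodule.mem_sup.1 hx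
      rw [Submodule.mem_comap, map_add]
      exact Submodule.add_mem_sup (hW f hf ha) (hW' f hf hb)
    · obtain ⟨a, ha, b, hb, rfl⟩ := Submodule.mem_sup.1 hx
      rw [star_add, add_comm]
      refine Submodule.add_mem_sup hb ?_
      rwa [hmem, star_star]
  rcases hinf with h | h
  · rcases hsup with h' | h'
    · exact absurd (sup_eq_bot_iff.1 h').1 hne
    · have := Submodule.finrank_sup_add_finrank_inf_eq W W'
      rw [h, h', hrank, finrank_top, finrank_bot, finrank_fin_fun] at this
      obtain ⟨r, hr⟩ := hn
      omega
  · exact (inf_eq_top_iff.1 h).1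

theorem weightOp_complexRep_ne_zero (hι : Function.Injective ι) : weightOp (complexRep ι) ≠ 0 := by
  intro h
  have h1 : complexRep ι L₃ = 0 := by simpa [weightOp] using h
  have h2 : (ι L₃).1.map Complex.ofRealHom = 0 := by
    apply Matrix.toLin'.injective
    rw [map_zero]
    exact h1
  have h3 : ι L₃ = 0 := by
    apply Subtype.ext
    ext i j
    simpa using congrFun (congrFun h2 i) j
  have h4 : L₃ = 0 := hι (by rw [h3, map_zero])
  have := congrFun (congrFun (congrArg Subtype.val h4) 1) 0
  simp [L₃] at this

/-- The complexified vector representation has highest weight `(n - 1)`. -/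
theorem exists_primitive_complexRep (hn : Odd n) (hι : Function.Injective ι)
    (hirr : IsIrreducibleSubspace (Set.range fun h : so 3 => Matrix.toLin' (ι h).1) ⊤) :
    ∃ v : Fin n → ℂ, (isSl2Triple _ (weightOp_complexRep_ne_zero hι)).HasPrimitiveVectorWith v
      (((n - 1 : ℕ) : ℂ)) := by
  have : NeZero n := ⟨by rintro rfl; exact absurd hn (by decide)⟩
  obtain ⟨μ, v, -, P⟩ :=
    (isSl2Triple _ (weightOp_complexRep_ne_zero hι)).exists_hasPrimitiveVectorWith (R := ℂ)
      (M := Fin n → ℂ)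
  obtain ⟨k, rfl⟩ := P.exists_nat
  obtain ⟨⟨h1, h2, -⟩, -⟩ := isIrrepOfHighestWeight_stringSpan _
    (weightOp_complexRep_ne_zero hι) P
  have h3 := finrank_stringSpan P
  rw [eq_top_of_invariant hn hirr h2 h1, finrank_top, finrank_fin_fun] at h3
  exact ⟨v, by rwa [show n - 1 = k by omega]⟩

end ComplexRep

section Wedge

variable {m : Type*} [Fintype m]

/-- The skew-symmetric matrix `v wᵀ - w vᵀ` corresponding to `v ∧ w`. -/
def wedge (v w : m → ℂ) : Matrix m m ℂ :=
  Matrix.vecMulVec v w - Matrix.vecMulVec w v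

/-- The commutator with a skew-symmetric matrix acts on bivectors as a derivation. -/
theorem mul_wedge_sub_wedge_mul {M : Matrix m m ℂ} (hM : M.transpose = -M) (v w : m → ℂ) :
    M * wedge v w - wedge v w * M = wedge (M.mulVec v) w + wedge v (M.mulVec w) := by
  have h : ∀ u, Matrix.vecMul u M = -M.mulVec u := fun u => by
    rw [← Matrix.mulVec_transpose, hM, Matrix.neg_mulVec]
  simp only [wedge, mul_sub, sub_mul, Matrix.mul_vecMulVec, Matrix.vecMulVec_mul, h,
    Matrix.vecMulVec_neg]
  abel

end Wedge

/-- The bivector `v₄ ∧ v₂` of vectors of weights `4` and `2` in `ℂ⁵`, written as `x + i y` with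
`x, y ∈ so(5)`, is a non-zero vector of weight `6` annihilated by the positive root vector. -/
theorem exists_weight_six {ι : so 3 →ₗ⁅ℝ⁆ so 5} (hι : Function.Injective ι)
    (hirr : IsIrreducibleSubspace (Set.range fun h : so 3 => Matrix.toLin' (ι h).1) ⊤) :
    ∃ x y : so 5, (x ≠ 0 ∨ y ≠ 0) ∧ ⁅ι L₃, x⁆ = (3 : ℝ) • y ∧ ⁅ι L₃, y⁆ = (-3 : ℝ) • x ∧
      ⁅ι L₁, x⁆ = ⁅ι L₂, y⁆ ∧ ⁅ι L₁, y⁆ = -⁅ι L₂, x⁆ := by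
  obtain ⟨v, P⟩ := exists_primitive_complexRep (by decide) hι hirr
  set t := isSl2Triple _ (weightOp_complexRep_ne_zero hι)
  set C : so 3 → Matrix (Fin 5) (Fin 5) ℂ := fun h => (ι h).1.map Complex.ofRealHom with hC
  have hskew : ∀ h, (C h).transpose = -C h := fun h => by
    ext i j
    simp [hC, so_apply_swap (ι h) i j]
  set w : Fin 5 → ℂ := loweringOp (complexRep ι) v with hw
  have hHv : ((2 * Complex.I) • C L₃).mulVec v = (4 : ℂ) • v := by
    rw [Matrix.smul_mulVec]
    have := P.lie_h
    norm_num at this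
    exact this
  have hHw : ((2 * Complex.I) • C L₃).mulVec w = (2 : ℂ) • w := by
    rw [Matrix.smul_mulVec]
    have := P.lie_h_pow_toEnd_f 1
    norm_num at this
    exact this
  have hEv : (Complex.I • C L₁ - C L₂).mulVec v = 0 := by
    rw [Matrix.sub_mulVec, Matrix.smul_mulVec]
    exact P.lie_e
  have hEw : (Complex.I • C L₁ - C L₂).mulVec w = (4 : ℂ) • v := by
    rw [Matrix.sub_mulVec, Matrix.smul_mulVec]
    have := P.lie_e_pow_succ_toEnd_f 0
    norm_num at this
    exact this
  have hli : LinearIndependent ℂ ![v, w] := by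
    have := (linearIndependent_string P).comp (Fin.castLE (show 2 ≤ 5 by norm_num))
      (Fin.castLE_injective _)
    have heq : ![v, w] = (fun j : Fin 5 => (toEnd ℂ (Module.End ℂ (Fin 5 → ℂ)) (Fin 5 → ℂ)
        (loweringOp (complexRep ι)) ^ (j : ℕ)) v) ∘ Fin.castLE (by norm_num) :=
      funext (Fin.forall_fin_two.2 ⟨rfl, rfl⟩)
    rw [heq]
    exact this
  set Z := wedge v w with hZ
  have hZ0 : Z ≠ 0 := by
    intro h0
    obtain ⟨i, hi⟩ : ∃ i, v i ≠ 0 := by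
      by_contra! hv
      exact P.ne_zero (funext hv)
    have h1 := LinearIndependent.pair_iff.1 hli (w i) (-v i) (by
      ext j
      have := congrFun (congrFun h0 j) i
      simp only [hZ, wedge, Matrix.sub_apply, Matrix.vecMulVec_apply, Matrix.zero_apply] at this
      simp only [Pi.add_apply, Pi.smul_apply, smul_eq_mul, Pi.zero_apply]
      linear_combination this)
    exact hi (neg_eq_zero.1 h1.2)
  have hZt : ∀ i j, Z j i = -Z i j := fun i j => by
    simp only [hZ, wedge, Matrix.sub_apply, Matrix.vecMulVec_apply]
    ring
  have hH := mul_wedge_sub_wedge_mul (M := (2 * Complex.I) • C L₃)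
    (by rw [Matrix.transpose_smul, hskew, smul_neg]) v w
  have hE := mul_wedge_sub_wedge_mul (M := Complex.I • C L₁ - C L₂)
    (by rw [Matrix.transpose_sub, Matrix.transpose_smul, hskew, hskew, smul_neg]; abel) v w
  rw [hHv, hHw, ← hZ] at hH
  rw [hEv, hEw, ← hZ] at hE
  -- As `C h` is real, the commutator with it acts on real and imaginary parts separately.
  have hre : ∀ h, (C h * Z - Z * C h).map Complex.re =
      (ι h).1 * Z.map Complex.re - Z.map Complex.re * (ι h).1 := fun h => by
    ext i j
    simp [hC, Matrix.mul_apply]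
  have him : ∀ h, (C h * Z - Z * C h).map Complex.im =
      (ι h).1 * Z.map Complex.im - Z.map Complex.im * (ι h).1 := fun h => by
    ext i j
    simp [hC, Matrix.mul_apply]
  -- The weight of `Z` is `4 + 2`; dividing `2 i [L₃, Z] = 6 Z` by two gives `i [L₃, Z] = 3 Z`.
  have hH' : Complex.I • (C L₃ * Z - Z * C L₃) = (3 : ℂ) • Z := by
    have h1 : wedge ((4 : ℂ) • v) w + wedge v ((2 : ℂ) • w) = (6 : ℂ) • Z := by
      ext i j
      simp only [hZ, wedge, Matrix.add_apply, Matrix.sub_apply, Matrix.vecMulVec_apply,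
        Matrix.smul_apply, Pi.smul_apply, smul_eq_mul]
      ring
    rw [h1, smul_mul_assoc, mul_smul_comm, ← smul_sub, mul_smul] at hH
    have := congrArg ((1 / 2 : ℂ) • ·) hH
    simpa [smul_smul, show (2⁻¹ * 6 : ℂ) = 3 by norm_num] using this
  -- `E (v ∧ F v) = v ∧ E F v = v ∧ 4 v = 0`.
  have hE' : Complex.I • (C L₁ * Z - Z * C L₁) = C L₂ * Z - Z * C L₂ := by
    have h1 : wedge 0 w + wedge v ((4 : ℂ) • v) = 0 := by
      ext i j
      simp only [wedge, Matrix.add_apply, Matrix.sub_apply, Matrix.vecMulVec_apply,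
        Matrix.zero_apply, Pi.zero_apply, Pi.smul_apply, smul_eq_mul]
      ring
    rw [h1] at hE
    rw [← sub_eq_zero, ← hE]
    simp only [sub_mul, mul_sub, smul_mul_assoc, mul_smul_comm, smul_sub]
    abel
  refine ⟨⟨Z.map Complex.re, ?_⟩, ⟨Z.map Complex.im, ?_⟩, ?_, ?_, ?_, ?_, ?_⟩
  · rw [LieAlgebra.Orthogonal.mem_so]
    ext i j
    simp [hZt i j]
  · rw [LieAlgebra.Orthogonal.mem_so]
    ext i j
    simp [hZt i j]
  · by_contra! h
    refine hZ0 ?_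
    ext i j
    exact Complex.ext (congrFun (congrFun (congrArg Subtype.val h.1) i) j)
      (congrFun (congrFun (congrArg Subtype.val h.2) i) j)
  all_goals
    apply Subtype.ext
    simp only [LieSubalgebra.coe_bracket, LieRing.of_associative_ring_bracket,
      NegMemClass.coe_neg, SetLike.val_smul]
    simp only [← hre, ← him]
    ext i j
    have h3 := congrFun (congrFun hH' i) j
    have h1 := congrFun (congrFun hE' i) j
    simp only [Complex.ext_iff, Matrix.smul_apply, smul_eq_mul, Complex.I_mul, Complex.mul_re,
      Complex.mul_im, Complex.re_ofNat, Complex.im_ofNat] at h1 h3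
    simp only [Matrix.map_apply, Matrix.smul_apply, Matrix.neg_apply, smul_eq_mul]
    linarith [h1.1, h1.2, h3.1, h3.2]

/-! ### Clifford multiplication by the isotropy representation -/

section Complement

variable {n : ℕ} {κ : Type*} [Fintype κ] [DecidableEq κ] {ι : so 3 →ₗ⁅ℝ⁆ so n}

theorem killingForm_lie_lie (a b c : so n) :
    killingForm ℝ (so n) a ⁅c, ⁅c, b⁆⁆ = killingForm ℝ (so n) ⁅c, ⁅c, a⁆⁆ b := by
  have h : ∀ x y, killingForm ℝ (so n) ⁅c, x⁆ y = -killingForm ℝ (so n) x ⁅c, y⁆ := fun x y =>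
    LieModule.traceForm_apply_lie_apply' ℝ (so n) (so n) c x y
  rw [h, h, neg_neg]

/-- Eigenvectors of `(ad (ι L₃))²` with eigenvalue `-9` are orthogonal to `ι(so(3))`, on which the
eigenvalues are `0` and `-1`. -/
theorem mem_complement_of_lie_lie {x : so n} (hx : ⁅ι L₃, ⁅ι L₃, x⁆⁆ = (-9 : ℝ) • x) :
    x ∈ complement ι := by
  have key : ∀ (y : so 3) (μ : ℝ), ⁅L₃, ⁅L₃, y⁆⁆ = μ • y → μ ≠ -9 →
      killingForm ℝ (so n) (ι y) x = 0 := by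
    intro y μ hy hμ
    have h := killingForm_lie_lie (ι y) x (ι L₃)
    rw [hx, ← LieHom.map_lie, ← LieHom.map_lie, hy, map_smul, map_smul, map_smul,
      LinearMap.smul_apply, smul_eq_mul, smul_eq_mul] at h
    have : (μ + 9) * killingForm ℝ (so n) (ι y) x = 0 := by linear_combination -h
    exact (mul_eq_zero.1 this).resolve_left fun h9 => hμ (by linarith)
  have h32 : ⁅L₃, L₂⁆ = -L₁ := by rw [← lie_skew, lie_L₂_L₃]
  have h1 := key L₁ (-1) (by rw [lie_L₃_L₁, h32, neg_one_smul]) (by norm_num)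
  have h2 := key L₂ (-1) (by rw [h32, lie_neg, lie_L₃_L₁, neg_one_smul]) (by norm_num)
  have h3 := key L₃ 0 (by simp) (by norm_num)
  rintro _ ⟨y, rfl⟩
  obtain ⟨a, b, c, rfl⟩ := so_three_eq y
  change killingForm ℝ (so n) (ι _) x = 0
  simp [h1, h2, h3]

theorem killingForm_self_neg {e : Basis κ ℝ (complement ι)} (he : IsOrthonormalBasis ι e)
    {v : complement ι} (hv : v ≠ 0) : killingForm ℝ (so n) v v < 0 := by
  have h1 : killingForm ℝ (so n) v v = -∑ i, killingForm ℝ (so n) (e i) v ^ 2 := by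
    have h2 : (v : so n) = ∑ i, (-killingForm ℝ (so n) (e i) v) • (e i : so n) := by
      have := congrArg (complement ι).subtype (expand he v)
      rw [map_sum] at this
      exact this
    conv_lhs => enter [1, 2]; rw [h2]
    rw [map_sum, LinearMap.sum_apply, ← Finset.sum_neg_distrib]
    refine Finset.sum_congr rfl fun i _ => ?_
    rw [map_smul, LinearMap.smul_apply, smul_eq_mul]
    ring
  rw [h1, neg_lt_zero]
  refine (Finset.sum_nonneg fun i _ => sq_nonneg _).lt_of_ne' fun h0 => hv ?_
  rw [Finset.sum_eq_zero_iff_of_nonneg fun i _ => sq_nonneg _] at h0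
  rw [expand he v]
  exact Finset.sum_eq_zero fun i hi => by rw [pow_eq_zero_iff two_ne_zero |>.1 (h0 i hi)]; simp

theorem finrank_so_five_le : finrank ℝ (so 5) ≤ 10 := by
  let f : so 5 →ₗ[ℝ] ({p : Fin 5 × Fin 5 // p.1 < p.2} → ℝ) :=
    { toFun := fun x p => x.1 p.1.1 p.1.2
      map_add' := fun x y => rfl
      map_smul' := fun c x => rfl }
  have hf : Function.Injective f := by
    refine (injective_iff_map_eq_zero f).2 fun x hx => Subtype.ext ?_
    have hlt : ∀ i j, i < j → x.1 i j = 0 := fun i j hij => congrFun hx ⟨(i, j), hij⟩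
    ext i j
    rcases lt_trichotomy i j with h | rfl | h
    · exact hlt i j h
    · have := so_apply_swap x i i
      change x.1 i i = 0
      linarith
    · rw [so_apply_swap x j i, hlt j i h]
      simp
  have hcard : Fintype.card {p : Fin 5 × Fin 5 // p.1 < p.2} = 10 := by decide
  have := LinearMap.finrank_le_finrank_of_injective hf
  rwa [finrank_fintype_fun_eq_card, hcard] at this

theorem three_le_finrank_so_three : 3 ≤ finrank ℝ (so 3) := by
  have hli : LinearIndependent ℝ ![L₁, L₂, L₃] := by
    refine Fintype.linearIndependent_iff.2 fun g hg => ?_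
    have h := fun i j => congrFun (congrFun (congrArg Subtype.val hg) i) j
    have h0 := h 2 1
    have h1 := h 0 2
    have h2 := h 1 0
    simp [Fin.sum_univ_three, L₁, L₂, L₃] at h0 h1 h2
    exact Fin.forall_fin_succ.2 ⟨h0, Fin.forall_fin_two.2 ⟨h1, h2⟩⟩
  simpa using hli.fintype_card_le_finrank

/-- The isotropy representation has dimension at most `10 - 3`: definiteness of the Killing form
on `𝔭` forces `𝔭 ∩ ι(so(3)) = 0`. -/
theorem finrank_complement_le {ι : so 3 →ₗ⁅ℝ⁆ so 5} (hι : Function.Injective ι)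
    {e : Basis κ ℝ (complement ι)} (he : IsOrthonormalBasis ι e) :
    finrank ℝ (complement ι) ≤ 7 := by
  have hinf : ι.range.toSubmodule ⊓ complement ι = ⊥ := by
    rw [Submodule.eq_bot_iff]
    rintro x ⟨hx, hx'⟩
    by_contra hx0
    have h1 := killingForm_self_neg he (v := ⟨x, hx'⟩) (by simpa using hx0)
    have h2 : killingForm ℝ (so 5) x x = 0 := hx' x hx
    exact h1.ne h2
  have hsum := Submodule.finrank_sup_add_finrank_inf_eq ι.range.toSubmodule (complement ι)
  have hle := Submodule.finrank_le (ι.range.toSubmodule ⊔ complement ι)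
  have hr : finrank ℝ ι.range.toSubmodule = finrank ℝ (so 3) :=
    LinearMap.finrank_range_of_inj (f := (ι : so 3 →ₗ[ℝ] so 5)) hι
  have h5 := finrank_so_five_le
  have h3 := three_le_finrank_so_three
  rw [hinf, finrank_bot] at hsum
  omega

end Complement

section Spinor

variable {n : ℕ} {κ : Type*} [Fintype κ] {ι : so 3 →ₗ⁅ℝ⁆ so n}
  {Δ : Type*} [AddCommGroup Δ] [Module ℂ Δ] (γ : Cl ι →ₐ[ℝ] Module.End ℂ Δ)

/-- Clifford multiplication of spinors by vectors of `𝔭`. -/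
noncomputable def cliffordMul : complement ι →ₗ[ℝ] Module.End ℂ Δ :=
  γ.toLinearMap.comp (CliffordAlgebra.ι (killingQuadraticForm ι))

theorem cliffordMul_anticomm (v w : complement ι) :
    cliffordMul γ v * cliffordMul γ w + cliffordMul γ w * cliffordMul γ v =
      ((2 * killingForm ℝ (so n) v w : ℝ) : ℂ) • (1 : Module.End ℂ Δ) := by
  have h := congrArg γ (CliffordAlgebra.ι_mul_ι_add_swap (Q := killingQuadraticForm ι) v w)
  rw [map_add, map_mul, map_mul, AlgHom.commutes, polar_killing,
    Algebra.algebraMap_eq_smul_one] at h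
  rw [Complex.coe_smul]
  exact h

theorem cliffordMul_sq (v : complement ι) :
    cliffordMul γ v * cliffordMul γ v =
      ((killingForm ℝ (so n) v v : ℝ) : ℂ) • (1 : Module.End ℂ Δ) := by
  have h := congrArg ((1 / 2 : ℂ) • ·) (cliffordMul_anticomm γ v v)
  simp only [← two_smul ℂ, smul_smul] at h
  norm_num at h
  rwa [← mul_assoc, show (1 / 2 * 2 : ℂ) = 1 by norm_num, one_mul] at h

/-- The complex span of the Clifford multiplications by vectors, `𝔭 ⊗ ℂ` inside `End(Δ)`. -/
def vectorSpan : Submodule ℂ (Module.End ℂ Δ) :=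
  Submodule.span ℂ (Set.range (cliffordMul γ))

theorem cliffordMul_mem (v : complement ι) : cliffordMul γ v ∈ vectorSpan γ :=
  Submodule.subset_span ⟨v, rfl⟩

theorem vectorSpan_anticomm {A B : Module.End ℂ Δ} (hA : A ∈ vectorSpan γ) (hB : B ∈ vectorSpan γ) :
    ∃ s : ℂ, A * B + B * A = s • (1 : Module.End ℂ Δ) := by
  induction hA, hB using Submodule.span_induction₂ with
  | mem_mem x y hx hy =>
    obtain ⟨v, rfl⟩ := hx
    obtain ⟨w, rfl⟩ := hy
    exact ⟨_, cliffordMul_anticomm γ v w⟩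
  | zero_left y hy => exact ⟨0, by simp⟩
  | zero_right x hx => exact ⟨0, by simp⟩
  | add_left x y z _ _ _ h1 h2 =>
    obtain ⟨s, hs⟩ := h1
    obtain ⟨r, hr⟩ := h2
    exact ⟨s + r, by rw [add_smul, ← hs, ← hr]; noncomm_ring⟩
  | add_right x y z _ _ _ h1 h2 =>
    obtain ⟨s, hs⟩ := h1
    obtain ⟨r, hr⟩ := h2
    exact ⟨s + r, by rw [add_smul, ← hs, ← hr]; noncomm_ring⟩
  | smul_left c x y _ _ h =>
    obtain ⟨s, hs⟩ := h
    exact ⟨c * s, by rw [mul_smul, ← hs, smul_mul_assoc, mul_smul_comm, smul_add]⟩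
  | smul_right c x y _ _ h =>
    obtain ⟨s, hs⟩ := h
    exact ⟨c * s, by rw [mul_smul, ← hs, smul_mul_assoc, mul_smul_comm, smul_add]⟩

theorem vectorSpan_eq_span_range (e : Basis κ ℝ (complement ι)) :
    vectorSpan γ = Submodule.span ℂ (Set.range fun i => cliffordMul γ (e i)) := by
  refine le_antisymm (Submodule.span_le.2 ?_) (Submodule.span_mono ?_)
  · rintro _ ⟨v, rfl⟩
    rw [← e.sum_repr v, map_sum]
    refine Submodule.sum_mem _ fun i _ => ?_
    rw [map_smul, ← Complex.coe_smul]
    exact Submodule.smul_mem _ _ (Submodule.subset_span ⟨i, rfl⟩)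
  · rintro _ ⟨i, rfl⟩
    exact ⟨e i, rfl⟩

theorem finiteDimensional_vectorSpan (e : Basis κ ℝ (complement ι)) :
    FiniteDimensional ℂ (vectorSpan γ) := by
  rw [vectorSpan_eq_span_range γ e]
  exact FiniteDimensional.span_of_finite ℂ (Set.finite_range _)

theorem finrank_vectorSpan_le (e : Basis κ ℝ (complement ι)) :
    finrank ℂ (vectorSpan γ) ≤ finrank ℝ (complement ι) := by
  rw [vectorSpan_eq_span_range γ e, finrank_eq_card_basis e]
  exact finrank_range_le_card _

variable {γ}

theorem eq_bot_or_eq_top_of_cliffordMul (hγ : IsSpinorModule γ) {U : Submodule ℂ Δ}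
    (hU : ∀ v, ∀ x ∈ U, cliffordMul γ v x ∈ U) : U = ⊥ ∨ U = ⊤ := by
  refine hγ.2.2 U le_top ?_
  rintro _ ⟨a, rfl⟩
  change ∀ x ∈ U, γ a x ∈ U
  induction a using CliffordAlgebra.induction with
  | algebraMap r =>
    intro x hx
    rw [AlgHom.commutes, Module.algebraMap_end_apply, ← Complex.coe_smul]
    exact U.smul_mem _ hx
  | ι v => exact hU v
  | mul a b ha hb =>
    intro x hx
    rw [map_mul]
    exact ha _ (hb _ hx)
  | add a b ha hb =>
    intro x hx
    rw [map_add]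
    exact U.add_mem (ha _ hx) (hb _ hx)

variable [DecidableEq κ] {e : Basis κ ℝ (complement ι)} (he : IsOrthonormalBasis ι e)

/-- Clifford multiplication is equivariant: `[ρ_*(h), v·] = (ζ_*(h) v)·`. -/
theorem lie_spinorRep_cliffordMul (h : so 3) (v : complement ι) :
    ⁅spinorRep he γ h, cliffordMul γ v⁆ = cliffordMul γ (isotropyRep ι h v) := by
  have := congrArg γ (spinLift_commutator he h v)
  rw [LieRing.of_associative_ring_bracket, map_sub, map_mul, map_mul] at this
  exact this

theorem lie_spinorRep_mem (h : so 3) {A : Module.End ℂ Δ} (hA : A ∈ vectorSpan γ) :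
    ⁅spinorRep he γ h, A⁆ ∈ vectorSpan γ := by
  induction hA using Submodule.span_induction with
  | mem x hx =>
    obtain ⟨v, rfl⟩ := hx
    rw [lie_spinorRep_cliffordMul]
    exact cliffordMul_mem γ _
  | zero => simp
  | add x y _ _ hx hy => rw [lie_add]; exact add_mem hx hy
  | smul c x _ hx => rw [lie_smul]; exact Submodule.smul_mem _ _ hx

theorem lie_loweringOp_mem {A : Module.End ℂ Δ} (hA : A ∈ vectorSpan γ) :
    ⁅loweringOp (spinorRep he γ), A⁆ ∈ vectorSpan γ := by
  rw [loweringOp, add_lie, smul_lie]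
  exact add_mem (Submodule.smul_mem _ _ (lie_spinorRep_mem he _ hA)) (lie_spinorRep_mem he _ hA)

end Spinor

/-- Clifford multiplication by the vector of weight `6` in `𝔭 ⊗ ℂ`. It is a primitive vector of
`End(Δ)`, and it does not anticommute with Clifford multiplication by its complex conjugate. -/
theorem exists_primitive_vectorSpan {κ : Type*} [Fintype κ] [DecidableEq κ]
    {ι : so 3 →ₗ⁅ℝ⁆ so 5} (hι : Function.Injective ι)
    (hirr : IsIrreducibleSubspace (Set.range fun h : so 3 => Matrix.toLin' (ι h).1) ⊤)
    {e : Basis κ ℝ (complement ι)} (he : IsOrthonormalBasis ι e)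
    {Δ : Type*} [AddCommGroup Δ] [Module ℂ Δ] [Nontrivial Δ] (γ : Cl ι →ₐ[ℝ] Module.End ℂ Δ) :
    ∃ Z ∈ vectorSpan γ, ∃ Z' ∈ vectorSpan γ, Z * Z' + Z' * Z ≠ 0 ∧
      ⁅weightOp (spinorRep he γ), Z⁆ = (6 : ℂ) • Z ∧ ⁅raisingOp (spinorRep he γ), Z⁆ = 0 := by
  obtain ⟨x, y, hxy, h3x, h3y, h1x, h1y⟩ := exists_weight_six hι hirr
  have hx : x ∈ complement ι := mem_complement_of_lie_lie (by
    rw [h3x, lie_smul, h3y, smul_smul]; norm_num)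
  have hy : y ∈ complement ι := mem_complement_of_lie_lie (by
    rw [h3y, lie_smul, h3x, smul_smul]; norm_num)
  set p : complement ι := ⟨x, hx⟩
  set q : complement ι := ⟨y, hy⟩
  have e3p : isotropyRep ι L₃ p = (3 : ℝ) • q := Subtype.ext h3x
  have e3q : isotropyRep ι L₃ q = (-3 : ℝ) • p := Subtype.ext h3y
  have e1p : isotropyRep ι L₁ p = isotropyRep ι L₂ q := Subtype.ext h1x
  have e1q : isotropyRep ι L₁ q = -isotropyRep ι L₂ p := Subtype.ext h1y
  have hle : ∀ v : complement ι, killingForm ℝ (so 5) v v ≤ 0 := fun v => by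
    by_cases hv : v = 0
    · simp [hv]
    · exact (killingForm_self_neg he hv).le
  have hlt : killingForm ℝ (so 5) p p + killingForm ℝ (so 5) q q < 0 := by
    rcases hxy with h | h
    · have := killingForm_self_neg he (v := p) fun h0 => h (congrArg Subtype.val h0)
      linarith [hle q]
    · have := killingForm_self_neg he (v := q) fun h0 => h (congrArg Subtype.val h0)
      linarith [hle p]
  refine ⟨cliffordMul γ p + Complex.I • cliffordMul γ q, ?_,
    cliffordMul γ p - Complex.I • cliffordMul γ q, ?_, ?_, ?_, ?_⟩
  · exact add_mem (cliffordMul_mem γ p) (Submodule.smul_mem _ _ (cliffordMul_mem γ q))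
  · exact sub_mem (cliffordMul_mem γ p) (Submodule.smul_mem _ _ (cliffordMul_mem γ q))
  · have hprod : (cliffordMul γ p + Complex.I • cliffordMul γ q) *
        (cliffordMul γ p - Complex.I • cliffordMul γ q) +
        (cliffordMul γ p - Complex.I • cliffordMul γ q) *
        (cliffordMul γ p + Complex.I • cliffordMul γ q) =
        (2 : ℂ) • (cliffordMul γ p * cliffordMul γ p) -
          (2 * (Complex.I * Complex.I)) • (cliffordMul γ q * cliffordMul γ q) := by
      simp only [add_mul, mul_add, sub_mul, mul_sub, smul_mul_assoc, mul_smul_comm]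
      module
    rw [hprod, cliffordMul_sq, cliffordMul_sq, Complex.I_mul_I, smul_smul, smul_smul, ← sub_smul]
    refine smul_ne_zero (fun h0 => hlt.ne ?_) one_ne_zero
    have : ((killingForm ℝ (so 5) p p + killingForm ℝ (so 5) q q : ℝ) : ℂ) = 0 := by
      push_cast
      linear_combination h0 / 2
    exact_mod_cast this
  · rw [weightOp, smul_lie, lie_add, lie_smul, lie_spinorRep_cliffordMul,
      lie_spinorRep_cliffordMul, e3p, e3q, map_smul, map_smul, ← Complex.coe_smul,
      ← Complex.coe_smul]
    match_scalars <;> ring_nf <;> simp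
  · rw [raisingOp, sub_lie, smul_lie, lie_add, lie_add, lie_smul, lie_smul,
      lie_spinorRep_cliffordMul, lie_spinorRep_cliffordMul, lie_spinorRep_cliffordMul,
      lie_spinorRep_cliffordMul, e1p, e1q, map_neg]
    match_scalars <;> ring_nf <;> simp

/-! ### Fock space of three fermions -/

section Fock

variable {V : Type*} [AddCommGroup V] [Module ℂ V]

/-- Operators satisfying the canonical anticommutation relations for three pairs of annihilation
operators `a i` and creation operators `b i`, together with an operator `z` of square `1` that
anticommutes with them: the generators of the complex Clifford algebra in seven dimensions. -/
structure IsFermionic (a b : Fin 3 → Module.End ℂ V) (z : Module.End ℂ V) : Prop where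
  aa : ∀ i j x, a i (a j x) = -a j (a i x)
  bb : ∀ i j x, b i (b j x) = -b j (b i x)
  ab : ∀ i j x, a i (b j x) = (if i = j then x else 0) - b j (a i x)
  az : ∀ i x, a i (z x) = -z (a i x)
  zb : ∀ i x, z (b i x) = -b i (z x)
  zz : ∀ x, z (z x) = x

/-- The vectors obtained from a vacuum vector `v` by the ordered products of distinct creation
operators; the binary digits of the index tell which operators occur. -/
def fockVector (b : Fin 3 → Module.End ℂ V) (v : V) : Fin 8 → V :=
  ![v, b 0 v, b 1 v, b 0 (b 1 v), b 2 v, b 0 (b 2 v), b 1 (b 2 v), b 0 (b 1 (b 2 v))]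

/-- The weights of the Fock vectors, if the vacuum has weight `c` and the creation operator `b i`
lowers weights by `d i`. -/
def fockWeight (d : Fin 3 → ℂ) (c : ℂ) : Fin 8 → ℂ :=
  ![c, c - d 0, c - d 1, c - d 0 - d 1, c - d 2, c - d 0 - d 2, c - d 1 - d 2,
    c - d 0 - d 1 - d 2]

theorem apply_fockVector {b : Fin 3 → Module.End ℂ V} {T : Module.End ℂ V} {d : Fin 3 → ℂ}
    (hT : ∀ i x, T (b i x) = b i (T x) - d i • b i x) {v : V} {c : ℂ} (hv : T v = c • v)
    (i : Fin 8) : T (fockVector b v i) = fockWeight d c i • fockVector b v i := by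
  fin_cases i <;> simp [fockVector, fockWeight, hT, hv] <;> module

variable {a b : Fin 3 → Module.End ℂ V} {z : Module.End ℂ V}

theorem eq_zero_of_eq_neg {x : V} (h : x = -x) : x = 0 := by
  have h2 : (2 : ℂ) • x = 0 := by rw [two_smul]; exact add_eq_zero_iff_eq_neg.2 h
  exact (smul_eq_zero.1 h2).resolve_left two_ne_zero

namespace IsFermionic

theorem a_self (h : IsFermionic a b z) (i : Fin 3) (x : V) : a i (a i x) = 0 :=
  eq_zero_of_eq_neg (h.aa i i x)

theorem b_self (h : IsFermionic a b z) (i : Fin 3) (x : V) : b i (b i x) = 0 :=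
  eq_zero_of_eq_neg (h.bb i i x)

/-- A vacuum vector, chosen as an eigenvector of `z`: applying `a 0`, `a 1`, `a 2` and `z + 1` in
turn to a non-zero vector, each only if the result is non-zero, yields one. -/
theorem exists_vacuum [Nontrivial V] (h : IsFermionic a b z) :
    ∃ v : V, v ≠ 0 ∧ (∀ i, a i v = 0) ∧ ∃ c : ℂ, z v = c • v := by
  have hk : ∀ i (x : V), x ≠ 0 → ∃ y, y ≠ 0 ∧ a i y = 0 ∧ ∀ j, a j x = 0 → a j y = 0 := by
    intro i x hx
    by_cases hi : a i x = 0
    · exact ⟨x, hx, hi, fun _ hj => hj⟩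
    · exact ⟨a i x, hi, h.a_self i x, fun j hj => by rw [h.aa, hj, map_zero, neg_zero]⟩
  obtain ⟨x, hx⟩ := exists_ne (0 : V)
  obtain ⟨x₀, hx₀, h0, -⟩ := hk 0 x hx
  obtain ⟨x₁, hx₁, h1, h1'⟩ := hk 1 x₀ hx₀
  obtain ⟨x₂, hx₂, h2, h2'⟩ := hk 2 x₁ hx₁
  have hvac : ∀ i, a i x₂ = 0 := Fin.forall_fin_succ.2
    ⟨h2' 0 (h1' 0 h0), Fin.forall_fin_two.2 ⟨h2' 1 h1, h2⟩⟩
  by_cases hz : x₂ + z x₂ = 0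
  · exact ⟨x₂, hx₂, hvac, -1, by rw [neg_one_smul]; exact eq_neg_of_add_eq_zero_right hz⟩
  · refine ⟨x₂ + z x₂, hz, fun i => ?_, 1, ?_⟩
    · rw [map_add, h.az, hvac, map_zero, neg_zero, add_zero]
    · rw [map_add, h.zz, one_smul, add_comm]

variable {v : V} {c : ℂ}

theorem fockVector_ne_zero (h : IsFermionic a b z) (hv : v ≠ 0) (ha : ∀ i, a i v = 0) (i : Fin 8) :
    fockVector b v i ≠ 0 := by
  have key : ∀ j x, a j x = 0 → a j (b j x) = x := fun j x hx => by simp [h.ab, hx]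
  have hb : ∀ j k x, j ≠ k → a j x = 0 → a j (b k x) = 0 := fun j k x hjk hx => by
    simp [h.ab, hx, hjk]
  have hne : ∀ j x, x ≠ 0 → a j x = 0 → b j x ≠ 0 := fun j x hx hj hbx => by
    have := key j x hj
    rw [hbx, map_zero] at this
    exact hx this.symm
  have h2 := hne 2 v hv (ha 2)
  have h1 := hne 1 v hv (ha 1)
  have h12 := hne 1 _ h2 (hb 1 2 v (by decide) (ha 1))
  fin_cases i
  · exact hv
  · exact hne 0 v hv (ha 0)
  · exact h1
  · exact hne 0 _ h1 (hb 0 1 v (by decide) (ha 0))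
  · exact h2
  · exact hne 0 _ h2 (hb 0 2 v (by decide) (ha 0))
  · exact h12
  · exact hne 0 _ h12 (hb 0 1 _ (by decide) (hb 0 2 v (by decide) (ha 0)))

/-- The operator that reads off the index of a Fock vector: the number operators `b i * a i`
weighted by powers of two. -/
def indexOp (a b : Fin 3 → Module.End ℂ V) : Module.End ℂ V :=
  b 0 * a 0 + (2 : ℂ) • (b 1 * a 1) + (4 : ℂ) • (b 2 * a 2)

theorem indexOp_fockVector (h : IsFermionic a b z) (ha : ∀ i, a i v = 0) (i : Fin 8) :
    indexOp a b (fockVector b v i) = ((i : ℕ) : ℂ) • fockVector b v i := by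
  have h1 : ∀ i x, indexOp a b (b i x) =
      b i (indexOp a b x) - (![-1, -2, -4] : Fin 3 → ℂ) i • b i x := by
    intro i x
    have e : ∀ j k (x : V), b j (a j (b k x)) = (if j = k then b k x else 0) + b k (b j (a j x)) :=
      fun j k x => by
        rw [h.ab, map_sub, h.bb j k]
        split_ifs with hjk <;> simp [hjk]
    simp only [indexOp, LinearMap.add_apply, LinearMap.smul_apply, Module.End.mul_apply, e, map_add,
      map_smul]
    fin_cases i <;> simp <;> module
  rw [apply_fockVector h1 (c := 0) (by simp [indexOp, ha])]
  congr 1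
  have h2 : (![-1, -2, -4] : Fin 3 → ℂ) 2 = -4 := rfl
  fin_cases i <;> norm_num [fockWeight, h2]

theorem linearIndependent_fockVector (h : IsFermionic a b z) (hv : v ≠ 0) (ha : ∀ i, a i v = 0) :
    LinearIndependent ℂ (fockVector b v) :=
  Module.End.eigenvectors_linearIndependent' (indexOp a b) (fun i : Fin 8 => ((i : ℕ) : ℂ))
    (fun _ _ hij => Fin.ext (Nat.cast_injective hij)) _ fun i =>
      ⟨Module.End.mem_eigenspace_iff.2 (h.indexOp_fockVector ha i), h.fockVector_ne_zero hv ha i⟩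

theorem span_fockVector_invariant (h : IsFermionic a b z) (ha : ∀ i, a i v = 0)
    (hz : z v = c • v) {x : V} (hx : x ∈ Submodule.span ℂ (Set.range (fockVector b v))) :
    (∀ i, a i x ∈ Submodule.span ℂ (Set.range (fockVector b v))) ∧
      (∀ i, b i x ∈ Submodule.span ℂ (Set.range (fockVector b v))) ∧
      z x ∈ Submodule.span ℂ (Set.range (fockVector b v)) := by
  set S := Submodule.span ℂ (Set.range (fockVector b v)) with hS
  have hm : ∀ i, fockVector b v i ∈ S := fun i => Submodule.subset_span ⟨i, rfl⟩
  obtain ⟨m0, m1, m2, m3, m4, m5, m6, m7⟩ : v ∈ S ∧ b 0 v ∈ S ∧ b 1 v ∈ S ∧ b 0 (b 1 v) ∈ S ∧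
      b 2 v ∈ S ∧ b 0 (b 2 v) ∈ S ∧ b 1 (b 2 v) ∈ S ∧ b 0 (b 1 (b 2 v)) ∈ S :=
    ⟨hm 0, hm 1, hm 2, hm 3, hm 4, hm 5, hm 6, hm 7⟩
  have b10 := h.bb 1 0
  have b20 := h.bb 2 0
  have b21 := h.bb 2 1
  have hle : ∀ T : Module.End ℂ V, (∀ i, T (fockVector b v i) ∈ S) → T x ∈ S := fun T hT => by
    have : S ≤ S.comap T := Submodule.span_le.2 (by rintro _ ⟨i, rfl⟩; exact hT i)
    exact this hx
  refine ⟨fun i => hle _ fun k => ?_, fun i => hle _ fun k => ?_, hle _ fun k => ?_⟩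
  · fin_cases k <;> fin_cases i <;>
      simp [fockVector, h.ab, ha, m0, m1, m2, m3, m4, m5, m6]
  · fin_cases k <;> fin_cases i <;>
      simp [fockVector, h.b_self, b10, b20, b21, m1, m2, m3, m4, m5, m6, m7]
  · fin_cases k <;>
      simp [fockVector, h.zb, hz, S.smul_mem, m0, m1, m2, m3, m4, m5, m6, m7]

/-- If the operators act irreducibly, then the Fock vectors form a basis. -/
theorem exists_basis (h : IsFermionic a b z)
    (hirr : ∀ U : Submodule ℂ V, (∀ x ∈ U, (∀ i, a i x ∈ U) ∧ (∀ i, b i x ∈ U) ∧ z x ∈ U) →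
      U = ⊥ ∨ U = ⊤)
    (hv : v ≠ 0) (ha : ∀ i, a i v = 0) (hz : z v = c • v) :
    ∃ B : Basis (Fin 8) ℂ V, ⇑B = fockVector b v := by
  have htop : Submodule.span ℂ (Set.range (fockVector b v)) = ⊤ := by
    refine (hirr _ fun x hx => h.span_fockVector_invariant ha hz hx).resolve_left fun hbot => ?_
    have : v ∈ Submodule.span ℂ (Set.range (fockVector b v)) := Submodule.subset_span ⟨0, rfl⟩
    rw [hbot] at this
    exact hv this
  exact ⟨Basis.mk (h.linearIndependent_fockVector hv ha) htop.ge, Basis.coe_mk _ _⟩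

end IsFermionic

/-- In a basis of eigenvectors of `T`, an eigenvector for `μ` has coordinates only at the basis
vectors of the same eigenvalue. -/
theorem repr_eq_zero_of_eigenvector {κ : Type*} {B : Basis κ ℂ V} {T : Module.End ℂ V} {w : κ → ℂ}
    (hT : ∀ i, T (B i) = w i • B i) {x : V} {μ : ℂ} (hx : T x = μ • x) {i : κ} (hi : w i ≠ μ) :
    B.repr x i = 0 := by
  have h1 : ∀ y, B.repr (T y) i = w i * B.repr y i := fun y => by
    have : (B.coord i).comp T = w i • B.coord i := B.ext fun j => by
      by_cases hij : j = i
      · subst hij; simp [hT]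
      · simp [hT, hij]
    simpa using LinearMap.congr_fun this y
  have h2 := h1 x
  rw [hx, map_smul, Finsupp.smul_apply, smul_eq_mul] at h2
  have h3 : (w i - μ) * B.repr x i = 0 := by linear_combination -h2
  exact (mul_eq_zero.1 h3).resolve_left (sub_ne_zero.2 hi)

/-- Fock space as a representation of `sl₂`, when the annihilation operators have weights `6`, `4`
and `2`. The Fock vectors are weight vectors, and as the trace of `H = [E, F]` vanishes, their
weights are `6, 4, 2, 0, 0, -2, -4, -6`. -/
theorem IsFermionic.exists_weight_basis [Nontrivial V] (h : IsFermionic a b z)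
    (hirr : ∀ U : Submodule ℂ V, (∀ x ∈ U, (∀ i, a i x ∈ U) ∧ (∀ i, b i x ∈ U) ∧ z x ∈ U) →
      U = ⊥ ∨ U = ⊤)
    {H E F : Module.End ℂ V} (t : IsSl2Triple H E F) {d : Fin 3 → ℂ} (hd : d = ![6, 4, 2])
    (ha : ∀ i, ⁅H, a i⁆ = d i • a i) (hb : ∀ i, ⁅H, b i⁆ = -d i • b i) :
    ∃ B : Basis (Fin 8) ℂ V, ∀ i, H (B i) = (![6, 0, 2, -4, 4, -2, 0, -6] : Fin 8 → ℂ) i • B i := by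
  obtain ⟨v, hv, hav, c, hzv⟩ := h.exists_vacuum
  obtain ⟨B, hB⟩ := h.exists_basis hirr hv hav hzv
  have hHa : ∀ i x, a i (H x) = H (a i x) - d i • a i x := fun i x => by
    have := LinearMap.congr_fun (ha i) x
    rw [LieRing.of_associative_ring_bracket] at this
    rw [← LinearMap.smul_apply, ← this]
    simp
  have hHb : ∀ i x, H (b i x) = b i (H x) - d i • b i x := fun i x => by
    have := LinearMap.congr_fun (hb i) x
    rw [LieRing.of_associative_ring_bracket] at this
    rw [sub_eq_add_neg, ← neg_smul, ← LinearMap.smul_apply, ← this]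
    simp
  -- The vacuum is unique up to scalars, so it is an eigenvector of `H`.
  obtain ⟨w, hw⟩ : ∃ w : ℂ, H v = w • v := by
    refine ⟨B.repr (H v) 0, ?_⟩
    have hN : IsFermionic.indexOp a b (H v) = (0 : ℂ) • H v := by
      simp [IsFermionic.indexOp, hHa, hav]
    have hz : ∀ i ≠ 0, B.repr (H v) i = 0 := fun i hi =>
      repr_eq_zero_of_eigenvector (fun j => by rw [hB]; exact h.indexOp_fockVector hav j) hN
        (by simpa using hi)
    have h0 : B 0 = v := by rw [hB]; rfl
    conv_lhs => rw [← B.sum_repr (H v)]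
    rw [Finset.sum_eq_single 0 (fun i _ hi => by rw [hz i hi, zero_smul]) (by simp), h0]
  have hHB : ∀ i, H (B i) = fockWeight d w i • B i := fun i => by
    rw [hB]
    exact apply_fockVector hHb hw i
  have htr : LinearMap.trace ℂ V H = ∑ i, fockWeight d w i := by
    rw [LinearMap.trace_eq_matrix_trace ℂ B, Matrix.trace]
    exact Finset.sum_congr rfl fun i _ => by simp [LinearMap.toMatrix_apply, hHB]
  have htr0 : LinearMap.trace ℂ V H = 0 := by
    rw [← t.lie_e_f, LieRing.of_associative_ring_bracket, map_sub, LinearMap.trace_mul_comm,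
      sub_self]
  have hw6 : w = 6 := by
    rw [htr] at htr0
    simp only [Fin.sum_univ_eight, fockWeight, hd] at htr0
    simp at htr0
    linear_combination htr0 / 8
  refine ⟨B, fun i => ?_⟩
  rw [hHB, hd, hw6]
  congr 1
  have h2 : (![6, 4, 2] : Fin 3 → ℂ) 2 = 2 := rfl
  fin_cases i <;> norm_num [fockWeight, h2]

end Fock

/-! ### Splitting off the trivial representation -/

section Decomposition

variable {V : Type*} [AddCommGroup V] [Module ℂ V] {ρ : so 3 →ₗ⁅ℝ⁆ Module.End ℂ V}

/-- A representation of `so(3)` with weights `6, 4, 2, 0, 0, -2, -4, -6` is `7 ⊕ 1`: the vector of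
weight `6` is primitive, and so is some vector of weight `0`, since the weight spaces of weights
`0` and `2` have dimensions two and one. -/
theorem exists_decomposition (h : weightOp ρ ≠ 0) (B : Basis (Fin 8) ℂ V)
    (hB : ∀ i, weightOp ρ (B i) = (![6, 0, 2, -4, 4, -2, 0, -6] : Fin 8 → ℂ) i • B i) :
    ∃ W₆ W₀ : Submodule ℂ V, IsCompl W₆ W₀ ∧ IsIrrepOfHighestWeight ρ W₆ 6 ∧ finrank ℂ W₆ = 7 ∧
      IsIrrepOfHighestWeight ρ W₀ 0 ∧ finrank ℂ W₀ = 1 := by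
  have hfin : FiniteDimensional ℂ V := Module.Finite.of_basis B
  set t := isSl2Triple ρ h
  -- `E` raises weights by two.
  have hE : ∀ (x : V) (μ : ℂ), weightOp ρ x = μ • x →
      weightOp ρ (raisingOp ρ x) = (μ + 2) • raisingOp ρ x := fun x μ hx => by
    simpa using t.lie_h_pow_toEnd_e (m := x) (μ := μ) hx 1
  obtain ⟨P⟩ : Nonempty (t.HasPrimitiveVectorWith (B 0) ((6 : ℕ) : ℂ)) := by
    refine ⟨⟨B.ne_zero 0, by simpa using hB 0, ?_⟩⟩
    have h8 := hE _ _ (hB 0)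
    refine B.repr.map_eq_zero_iff.1 (Finsupp.ext fun i => ?_)
    exact repr_eq_zero_of_eigenvector hB h8 (by fin_cases i <;> norm_num)
  obtain ⟨w, Q⟩ : ∃ w, t.HasPrimitiveVectorWith w ((0 : ℕ) : ℂ) := by
    have h2 : ∀ i, weightOp ρ (B i) = (0 : ℂ) • B i → ∃ c : ℂ, raisingOp ρ (B i) = c • B 2 := by
      intro i hi
      have h2 := hE _ _ hi
      refine ⟨B.repr (raisingOp ρ (B i)) 2, ?_⟩
      conv_lhs => rw [← B.sum_repr (raisingOp ρ (B i))]
      refine Finset.sum_eq_single 2 (fun j _ hj => ?_) (by simp)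
      rw [repr_eq_zero_of_eigenvector hB h2, zero_smul]
      fin_cases j <;> first | exact absurd rfl hj | norm_num
    have hB1 : weightOp ρ (B 1) = (0 : ℂ) • B 1 := hB 1
    have hB6 : weightOp ρ (B 6) = (0 : ℂ) • B 6 := hB 6
    obtain ⟨c, hc⟩ := h2 1 hB1
    obtain ⟨d, hd⟩ := h2 6 hB6
    by_cases hc0 : c = 0
    · exact ⟨B 1, B.ne_zero 1, by simpa using hB1, by simpa [hc0] using hc⟩
    -- `E` maps `B 1` to `c • B 2` and `B 6` to `d • B 2`, so this combination is in its kernel.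
    · refine ⟨d • B 1 - c • B 6, fun h0 => hc0 ?_, ?_, ?_⟩
      · simpa using congrArg (B.coord 6) h0
      · simp [hB1, hB6]
      · change raisingOp ρ _ = 0
        rw [map_sub, map_smul, map_smul, hc, hd]
        module
  refine ⟨stringSpan (Module.End ℂ V) (loweringOp ρ) (B 0) 6,
    stringSpan (Module.End ℂ V) (loweringOp ρ) w 0, ?_,
    isIrrepOfHighestWeight_stringSpan ρ h P, finrank_stringSpan P,
    isIrrepOfHighestWeight_stringSpan ρ h Q, finrank_stringSpan Q⟩
  refine (Submodule.isCompl_iff_disjoint _ _ ?_).2 ?_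
  · rw [finrank_stringSpan P, finrank_stringSpan Q, finrank_eq_card_basis B, Fintype.card_fin]
  · rw [Submodule.disjoint_def]
    intro x hx hx'
    obtain ⟨c, hc⟩ : ∃ c : ℂ, c • w = x := by
      have h1 : Set.range (fun j : Fin (0 + 1) =>
          (toEnd ℂ (Module.End ℂ V) V (loweringOp ρ) ^ (j : ℕ)) w) = {w} := by
        ext; simp [eq_comm]
      rw [stringSpan, h1] at hx'
      exact Submodule.mem_span_singleton.1 hx'
    obtain ⟨d, hd⟩ := eq_smul_of_lie_e_eq_zero P hx (by rw [← hc, lie_smul, Q.lie_e, smul_zero])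
    have e1 : weightOp ρ x = 0 := by
      rw [← hc, map_smul]
      have := Q.lie_h
      simp only [Nat.cast_zero, zero_smul] at this
      exact (congrArg (c • ·) this).trans (smul_zero c)
    have e2 : weightOp ρ x = (6 : ℂ) • x := by
      rw [hd, map_smul, hB 0, smul_comm]
      rfl
    rw [e1] at e2
    simpa using e2.symm

end Decomposition

/-! ### The spinor representation -/

section CliffordString

variable {V : Type*} [AddCommGroup V] [Module ℂ V] {H E F Z : Module.End ℂ V}
  {t : IsSl2Triple H E F}

/-- If the members of the `F`-string of a primitive vector `Z` anticommute up to scalars, then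
weights show that two of them anticommute unless their weights are opposite, and the invariance of
the anticommutator under `F` determines the remaining anticommutators up to one scalar. -/
theorem string_anticomm [Nontrivial V] (P : t.HasPrimitiveVectorWith Z ((6 : ℕ) : ℂ))
    (hs : ∀ i j, ∃ s : ℂ, (toEnd ℂ (Module.End ℂ V) (Module.End ℂ V) F ^ i) Z *
        (toEnd ℂ (Module.End ℂ V) (Module.End ℂ V) F ^ j) Z +
      (toEnd ℂ (Module.End ℂ V) (Module.End ℂ V) F ^ j) Z *
        (toEnd ℂ (Module.End ℂ V) (Module.End ℂ V) F ^ i) Z = s • (1 : Module.End ℂ V)) :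
    ∃ β : ℂ, ∀ i j, (toEnd ℂ (Module.End ℂ V) (Module.End ℂ V) F ^ i) Z *
        (toEnd ℂ (Module.End ℂ V) (Module.End ℂ V) F ^ j) Z +
      (toEnd ℂ (Module.End ℂ V) (Module.End ℂ V) F ^ j) Z *
        (toEnd ℂ (Module.End ℂ V) (Module.End ℂ V) F ^ i) Z =
      if i + j = 6 then ((-1) ^ i * β) • (1 : Module.End ℂ V) else 0 := by
  set ψ : ℕ → Module.End ℂ V := fun i => (toEnd ℂ (Module.End ℂ V) (Module.End ℂ V) F ^ i) Z
    with hψ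
  change ∀ i j, ∃ s : ℂ, ψ i * ψ j + ψ j * ψ i = s • (1 : Module.End ℂ V) at hs
  change ∃ β : ℂ, ∀ i j, ψ i * ψ j + ψ j * ψ i = _
  have leib : ∀ A B C : Module.End ℂ V,
      ⁅A, B * C + C * B⁆ = ⁅A, B⁆ * C + B * ⁅A, C⁆ + (⁅A, C⁆ * B + C * ⁅A, B⁆) := fun A B C => by
    simp only [LieRing.of_associative_ring_bracket]
    noncomm_ring
  have hF : ∀ i, ⁅F, ψ i⁆ = ψ (i + 1) := P.lie_f_pow_toEnd_f
  have hH : ∀ i : ℕ, ⁅H, ψ i⁆ = (6 - 2 * i : ℂ) • ψ i := P.lie_h_pow_toEnd_f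
  have hscalar : ∀ (A : Module.End ℂ V) (s : ℂ), ⁅A, s • (1 : Module.End ℂ V)⁆ = 0 := fun A s => by
    simp [LieRing.of_associative_ring_bracket]
  have hzero : ∀ i j, i + j ≠ 6 → ψ i * ψ j + ψ j * ψ i = 0 := fun i j hij => by
    obtain ⟨s, h⟩ := hs i j
    have h1 := leib H (ψ i) (ψ j)
    rw [hH, hH, h, hscalar] at h1
    have h2 : (12 - 2 * i - 2 * j : ℂ) • (ψ i * ψ j + ψ j * ψ i) = 0 := by
      rw [h1]
      simp only [smul_mul_assoc, mul_smul_comm]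
      module
    refine (smul_eq_zero.1 h2).resolve_left fun h0 => hij ?_
    have : ((i + j : ℕ) : ℂ) = (6 : ℕ) := by push_cast; linear_combination -h0 / 2
    exact_mod_cast this
  have hshift : ∀ i j, i + j = 5 →
      ψ (i + 1) * ψ j + ψ j * ψ (i + 1) = -(ψ i * ψ (j + 1) + ψ (j + 1) * ψ i) := fun i j hij => by
    have h1 := leib F (ψ i) (ψ j)
    rw [hF, hF, hzero i j (by omega), lie_zero] at h1
    rw [eq_neg_iff_add_eq_zero, h1]
    abel
  obtain ⟨β, hβ⟩ := hs 0 6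
  refine ⟨β, fun i => ?_⟩
  induction i with
  | zero =>
    intro j
    split_ifs with hj
    · obtain rfl : j = 6 := by omega
      rw [hβ, pow_zero, one_mul]
    · exact hzero 0 j hj
  | succ i ih =>
    intro j
    split_ifs with hj
    · rw [hshift i j (by omega), ih, if_pos (by omega), pow_succ, ← neg_smul]
      congr 1
      ring
    · exact hzero _ j hj

/-- The anticommutation relations of a string of weights `6, 4, …, -6`, normalised: members of
opposite weights become annihilation and creation operators. -/
theorem isFermionic_of_anticomm {ψ : ℕ → Module.End ℂ V} {β s : ℂ}
    (h : ∀ i j, ψ i * ψ j + ψ j * ψ i =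
      if i + j = 6 then ((-1) ^ i * β) • (1 : Module.End ℂ V) else 0)
    (hβ : β ≠ 0) (hs : -β / 2 = s * s) :
    IsFermionic (fun i => ψ i) (fun i => ((-1) ^ (i : ℕ) * β)⁻¹ • ψ (6 - i)) (s⁻¹ • ψ 3) := by
  have hanti : ∀ i j, i + j ≠ 6 → ∀ x, ψ i (ψ j x) = -ψ j (ψ i x) := fun i j hij x => by
    have := LinearMap.congr_fun (h i j) x
    rw [if_neg hij] at this
    exact eq_neg_of_add_eq_zero_left this
  refine ⟨fun i j x => ?_, fun i j x => ?_, fun i j x => ?_, fun i x => ?_, fun i x => ?_,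
    fun x => ?_⟩
  all_goals try simp only [LinearMap.smul_apply, map_smul]
  · exact hanti _ _ (by omega) x
  · rw [hanti _ _ (by omega) x, smul_neg, smul_neg, smul_comm]
  · by_cases hij : i = j
    · subst hij
      have h1 := LinearMap.congr_fun (h i (6 - i)) x
      rw [if_pos (by omega)] at h1
      simp only [LinearMap.add_apply, Module.End.mul_apply, LinearMap.smul_apply,
        Module.End.one_apply] at h1
      rw [if_pos rfl, eq_sub_iff_add_eq, ← smul_add, h1, smul_smul,
        inv_mul_cancel₀ (mul_ne_zero (pow_ne_zero _ (by norm_num)) hβ), one_smul]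
    · rw [if_neg hij, zero_sub, hanti _ _ (fun h6 => hij (Fin.ext (by omega))) x, smul_neg]
  · rw [hanti _ _ (by omega) x, smul_neg]
  · rw [hanti _ _ (by omega) x, smul_neg, smul_neg, smul_comm]
  · have h1 := LinearMap.congr_fun (h 3 3) x
    simp only [LinearMap.add_apply, Module.End.mul_apply, LinearMap.smul_apply,
      Module.End.one_apply, if_true, Nat.reduceAdd] at h1
    have hs0 : s ≠ 0 := by
      rintro rfl
      simp [hβ] at hs
    have h2 : ψ 3 (ψ 3 x) = (s * s) • x := by
      rw [← two_smul ℂ] at h1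
      have := congrArg ((1 / 2 : ℂ) • ·) h1
      simp only [smul_smul] at this
      rw [← hs]
      convert this using 1
      · norm_num
      · congr 1; ring
    rw [h2, smul_smul, smul_smul, show s⁻¹ * s⁻¹ * (s * s) = 1 by field_simp, one_smul]

end CliffordString

end BergerSpace

theorem mainTheorem8
    -- an embedding of `so(3)` into `so(5)` under which the vector representation `ℝ⁵` of `so(5)`
    -- stays irreducible
    (ι : BergerSpace.so 3 →ₗ⁅ℝ⁆ BergerSpace.so 5)
    (hι : Function.Injective ι)
    (hirr : BergerSpace.IsIrreducibleSubspace
      (Set.range fun h : BergerSpace.so 3 =>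
        Matrix.toLin' (ι h : Matrix (Fin 5) (Fin 5) ℝ)) ⊤)
    -- an orthonormal basis of the complement `𝔭` of `so(3)` in `so(5)`
    {n : ℕ} (e : Module.Basis (Fin n) ℝ (BergerSpace.complement ι))
    (he : BergerSpace.IsOrthonormalBasis ι e)
    -- a complex spinor module of `Cℓ(𝔭)`
    {Δ : Type*} [AddCommGroup Δ] [Module ℂ Δ]
    (γ : BergerSpace.Cl ι →ₐ[ℝ] Module.End ℂ Δ)
    (hγ : BergerSpace.IsSpinorModule γ) :
    Module.finrank ℂ Δ = 8 ∧
    ∃ W₆ W₀ : Submodule ℂ Δ,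
      IsCompl W₆ W₀ ∧
      BergerSpace.IsIrrepOfHighestWeight (BergerSpace.spinorRep he γ) W₆ 6 ∧
      Module.finrank ℂ W₆ = 7 ∧
      BergerSpace.IsIrrepOfHighestWeight (BergerSpace.spinorRep he γ) W₀ 0 ∧
      Module.finrank ℂ W₀ = 1 := by
  have hnt : Nontrivial Δ := by
    by_contra h
    rw [not_nontrivial_iff_subsingleton] at h
    exact hγ.1 (Subsingleton.elim _ _)
  set ρ := BergerSpace.spinorRep he γ
  obtain ⟨Z, hZ, Z', hZ', hZZ', hHZ, hEZ⟩ := BergerSpace.exists_primitive_vectorSpan hι hirr he γ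
  have hZ0 : Z ≠ 0 := by
    rintro rfl
    simp at hZZ'
  have hH0 : BergerSpace.weightOp ρ ≠ 0 := by
    intro h0
    rw [h0, zero_lie] at hHZ
    exact hZ0 ((smul_eq_zero.1 hHZ.symm).resolve_left (by norm_num))
  have P : (BergerSpace.isSl2Triple ρ hH0).HasPrimitiveVectorWith Z ((6 : ℕ) : ℂ) :=
    ⟨hZ0, by simpa using hHZ, hEZ⟩
  set F := BergerSpace.loweringOp ρ
  set ψ : ℕ → Module.End ℂ Δ := fun i =>
    (LieModule.toEnd ℂ (Module.End ℂ Δ) (Module.End ℂ Δ) F ^ i) Z with hψ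
  have hψmem : ∀ i, ψ i ∈ BergerSpace.vectorSpan γ := fun i => by
    induction i with
    | zero => exact hZ
    | succ i ih =>
      rw [hψ]
      dsimp only
      rw [pow_succ']
      exact BergerSpace.lie_loweringOp_mem he ih
  -- The string of `Z` has seven members, so it spans the at most seven-dimensional `𝔭 ⊗ ℂ`.
  have hspan : BergerSpace.stringSpan (Module.End ℂ Δ) F Z 6 = BergerSpace.vectorSpan γ := by
    have := BergerSpace.finiteDimensional_vectorSpan γ e
    refine Submodule.eq_of_le_of_finrank_le (Submodule.span_le.2 ?_) ?_
    · rintro _ ⟨i, rfl⟩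
      exact hψmem i
    · rw [BergerSpace.finrank_stringSpan P]
      exact (BergerSpace.finrank_vectorSpan_le γ e).trans (BergerSpace.finrank_complement_le hι he)
  obtain ⟨β, hβ⟩ := BergerSpace.string_anticomm P fun i j =>
    BergerSpace.vectorSpan_anticomm γ (hψmem i) (hψmem j)
  change ∀ i j, ψ i * ψ j + ψ j * ψ i = _ at hβ
  -- Were all anticommutators in `𝔭 ⊗ ℂ` zero, then so would be that of `Z` and its conjugate.
  have hβ0 : β ≠ 0 := by
    rintro rfl
    rw [← hspan] at hZ'
    obtain ⟨c, rfl⟩ := (Submodule.mem_span_range_iff_exists_fun ℂ).1 hZ'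
    refine hZZ' ?_
    rw [Finset.mul_sum, Finset.sum_mul, ← Finset.sum_add_distrib]
    refine Finset.sum_eq_zero fun j _ => ?_
    rw [mul_smul_comm, smul_mul_assoc, ← smul_add]
    have := hβ 0 j
    simp only [mul_zero, zero_smul, ite_self] at this
    exact (congrArg (c j • ·) this).trans (smul_zero _)
  -- The member `ψ 3` of weight `0` has square `-β / 2`, and `s⁻¹ • ψ 3` has square `1`.
  obtain ⟨s, hs⟩ := IsAlgClosed.exists_eq_mul_self (-β / 2)
  have hfock := BergerSpace.isFermionic_of_anticomm hβ hβ0 hs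
  have hs0 : s ≠ 0 := by
    rintro rfl
    simp [hβ0] at hs
  have hirrψ : ∀ U : Submodule ℂ Δ, (∀ j ≤ 6, ∀ x ∈ U, ψ j x ∈ U) → U = ⊥ ∨ U = ⊤ := by
    intro U hU
    refine BergerSpace.eq_bot_or_eq_top_of_cliffordMul hγ fun v x hx => ?_
    have hv := BergerSpace.cliffordMul_mem γ v
    rw [← hspan] at hv
    obtain ⟨c, hc⟩ := (Submodule.mem_span_range_iff_exists_fun ℂ).1 hv
    rw [← hc, LinearMap.sum_apply]
    exact U.sum_mem fun j _ => U.smul_mem _ (hU j (by omega) x hx)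
  have hH : ∀ i : ℕ, ⁅BergerSpace.weightOp ρ, ψ i⁆ = (6 - 2 * i : ℂ) • ψ i := P.lie_h_pow_toEnd_f
  obtain ⟨B, hB⟩ := hfock.exists_weight_basis (d := ![6, 4, 2])
    (fun U hU => hirrψ U fun j hj x hx => by
      obtain ⟨h1, h2, h3⟩ := hU x hx
      have hcancel : ∀ (c : ℂ) (y : Δ), c ≠ 0 → c⁻¹ • y ∈ U → y ∈ U := fun c y hc hy => by
        have := U.smul_mem c hy
        rwa [smul_smul, mul_inv_cancel₀ hc, one_smul] at this
      rcases lt_trichotomy j 3 with hj3 | rfl | hj3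
      · exact h1 ⟨j, hj3⟩
      · exact hcancel s _ hs0 h3
      · have := hcancel _ _ (mul_ne_zero (pow_ne_zero _ (by norm_num)) hβ0) (h2 ⟨6 - j, by omega⟩)
        rwa [show 6 - (6 - j) = j by omega] at this)
    (BergerSpace.isSl2Triple ρ hH0) rfl
    (fun i => by
      rw [hH]
      congr 1
      fin_cases i <;> norm_num)
    (fun i => by
      rw [lie_smul, hH, smul_comm]
      congr 1
      fin_cases i <;> norm_num)
  exact ⟨by rw [Module.finrank_eq_card_basis B, Fintype.card_fin],
    BergerSpace.exists_decomposition hH0 B hB⟩
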